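/- Let $\Delta$ be a (finite, reduced, crystallographic) root system spanning a real vector space, with a choice of simple roots, positive roots $\Delta^+$ and negative roots $\Delta^-=-\Delta^+$. Let $W$ be its Weyl group, $l(w)=\#(\Delta^+\cap w^{-1}\Delta^-)$ the length of $w\in W$, and $w_0\in W$ the longest element, i.e. the one with $l(w_0)=\#\Delta^+$. Let $\Lambda^+$ be the set of dominant integral weights, let $\Lambda^+_{\rm sd}=\{\lambda\in\Lambda^+ : -w_0\lambda=\lambda\}$ be the set of self-dual dominant weights, and let ${\rm Cone}(\Delta^+)$ be the real convex cone generated by the positive roots. Put $$\ell_\Delta=\min\{l(w): w\in W,\ w\Lambda^+\nsubseteq {\rm Cone}(\Delta^+)\},\qquad \ell_\Delta^{\rm sd}=\min\{l(w): w\in W,\ w\Lambda^+_{\rm sd}\nsubseteq {\rm Cone}(\Delta^+)\}.$$ **Theorem.** For the simple root systems the values of these invariants are as follows. - Type $\mathbf A_n$ ($n\ge1$): $\ell_\Delta=1$ and $\ell_\Delta^{\rm sd}=\lfloor\frac{n+2}{2}\rfloor$. - Type $\mathbf B_n$ ($n\ge2$): $\ell_\Delta=\ell_\Delta^{\rm sd}=n$.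 - Type $\mathbf C_n$ ($n\ge2$): $\ell_\Delta=\ell_\Delta^{\rm sd}=n$. - Type $\mathbf D_n$ ($n\ge4$): $\ell_\Delta=n-1$ for $n\ne5$, and $\ell_\Delta=3$ for $n=5$; $\ell_\Delta^{\rm sd}=n-1$ for all $n\geq 4$. - Type $\mathbf E_6$: $\ell_\Delta=5$ and $\ell_\Delta^{\rm sd}=9$. - Type $\mathbf E_7$: $\ell_\Delta=\ell_\Delta^{\rm sd}=10$. - Type $\mathbf E_8$: $7\le\ell_\Delta\le29$ and $\ell_\Delta^{\rm sd}=\ell_\Delta$. - Type $\mathbf F_4$: $\ell_\Delta=\ell_\Delta^{\rm sd}=8$. - Type $\mathbf G_2$: $\ell_\Delta=\ell_\Delta^{\rm sd}=3$. -/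

import Mathlib

noncomputable section

namespace RootPairing.Base

variable {ι M N : Type*} [AddCommGroup M] [Module ℝ M] [AddCommGroup N] [Module ℝ N]
  {P : RootPairing ι ℝ M N}

/-- The length `l(w) = #(Δ⁺ ∩ w⁻¹ Δ⁻)` of a Weyl group element: the number of positive roots that
`w` sends to negative roots (a root is negative when it is not positive). -/
def weylLength (b : P.Base) (w : P.weylGroup) : ℕ :=
  {i : ι | b.IsPos i ∧ ¬ b.IsPos (w • i)}.ncard

/-- `w` is the longest element `w₀` of the Weyl group, i.e. `l(w) = #Δ⁺`. -/
def IsLongestElement (b : P.Base) (w : P.weylGroup) : Prop :=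
  b.weylLength w = {i : ι | b.IsPos i}.ncard

/-- The set `Λ⁺` of dominant integral weights: `λ` takes integral values on all coroots and
non-negative values on the simple coroots. -/
def dominantWeights (b : P.Base) : Set M :=
  {v : M | (∀ i : ι, ∃ z : ℤ, P.coroot' i v = (z : ℝ)) ∧ ∀ i ∈ b.support, 0 ≤ P.coroot' i v}

/-- The set `Λ⁺_sd` of self-dual dominant weights: those `λ ∈ Λ⁺` with `-w₀ λ = λ`, where `w₀` is
the longest element of the Weyl group. -/
def selfDualDominantWeights (b : P.Base) : Set M :=
  {v : M | v ∈ b.dominantWeights ∧ ∃ w₀ : P.weylGroup, b.IsLongestElement w₀ ∧ -(w₀ • v) = v}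

/-- `Cone(Δ⁺)`: the real convex cone of non-negative combinations of positive roots. -/
def positiveRootCone (b : P.Base) : PointedCone ℝ M :=
  PointedCone.hull ℝ (P.root '' {i : ι | b.IsPos i})

/-- `ℓ_Δ = min {l(w) : w ∈ W, w Λ⁺ ⊄ Cone(Δ⁺)}`. -/
def ellInvariant (b : P.Base) : ℕ :=
  sInf {l : ℕ | ∃ w : P.weylGroup, b.weylLength w = l ∧
    ¬ ∀ v ∈ b.dominantWeights, w • v ∈ b.positiveRootCone}

/-- `ℓ_Δ^sd = min {l(w) : w ∈ W, w Λ⁺_sd ⊄ Cone(Δ⁺)}`. -/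
def ellSdInvariant (b : P.Base) : ℕ :=
  sInf {l : ℕ | ∃ w : P.weylGroup, b.weylLength w = l ∧
    ¬ ∀ v ∈ b.selfDualDominantWeights, w • v ∈ b.positiveRootCone}

/-- The root system has the type given by the Cartan matrix `A`: the Cartan matrix with respect to
the base `b` is `A`, for some numbering of the simple roots. -/
def HasCartanType [P.IsCrystallographic] (b : P.Base) {n : ℕ} (A : Matrix (Fin n) (Fin n) ℤ) :
    Prop :=
  ∃ e : b.support ≃ Fin n, ∀ i j : b.support, b.cartanMatrix i j = A (e i) (e j)

end RootPairing.Base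

end

/-!
For a vector `v`, let `N(v)` (`negCount`) be the number of positive coroots that are negative at
`v`. If `v` is dominant then `l(w) ≥ N(w v)` (`negCount_smul_le`). Lower bounds for both invariants
therefore follow from lower bounds for `N` on the vectors outside the cone of the positive roots
that lie in the orbit of a (self-dual) dominant weight; the upper bounds are given by explicit
weights and words in the simple reflections. Self-duality of a dominant weight `v` means that `-v`
lies in the orbit of `v` (`mem_selfDualDominantWeights_iff`), since an orbit contains only one
dominant vector (`eq_of_dominant_of_smul_eq`).

For the classical types the weight space is given the usual coordinates `x_0, x_1, …`
(`exists_realization`), for which the positive coroots are, up to factors, functionals `x_a - x_c`,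
`x_a + x_c` with `a < c`, and `x_a`. A vector is outside the cone if and only if some partial sum
`x_0 + ⋯ + x_{j-1}` is negative (with a modification at the end of type `D`).
* In types `B` and `C`, for each `t < j` there is a pair of indices with sum `t` modulo `j` on which
  `x` has a negative sum, as the average over all pairs is negative. For each `t ≥ j` some negative
  coordinate `x_a` with `a < j` makes one of `x_a ± x_t` negative. This gives as many negative
  coroots as the rank.
* In type `D` the same argument works with a loss of one if not all coordinates are involved. For a
  negative sum of all `n` coordinates, at least `n - 1` sums of two coordinates are negative unless
  `n` is `3` or `5` (`card_neg_pairs_ge`).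
* In type `A`, self-dual weights have coordinates symmetric about `0`, and pairs of coordinates on
  different sides of a threshold are counted (`le_card_lt_pairs_of_symm`).

For the exceptional types and `D₅` a dominant vector is a non-negative combination of the
fundamental weights, and a self-dual one of sums of a fundamental weight and its dual. So it
suffices to check that the vectors `v` with `N(v) ≤ d` in the orbits of these finitely many vectors
are in the cone. Each of these is reached from the dominant one by at most `d` simple reflections,
which makes the check a finite computation (`smul_mem_positiveRootCone_of_conesBelow`). For `E₇`,
`E₈`, `F₄` and `G₂` a power of a Coxeter element is `-1`, so all dominant weights are self-dual.
-/

set_option linter.unusedSectionVars false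

namespace RootPairing.Base

/-! ### Reflections in the Weyl group and coroots -/

section WeylAction

variable {ι M N : Type*} [AddCommGroup M] [Module ℝ M] [AddCommGroup N] [Module ℝ N]
  {P : RootPairing ι ℝ M N}

lemma root_weylGroup_smul (w : P.weylGroup) (i : ι) : P.root (w • i) = w • P.root i :=
  (P.weylGroup_apply_root w i).symm

lemma ofIdx_smul_index (i j : ι) : weylGroup.ofIdx P i • j = P.reflectionPerm i j := rfl

lemma ofIdx_smul_eq (i : ι) (v : M) :
    weylGroup.ofIdx P i • v = v - P.coroot' i v • P.root i := rfl

lemma ofIdx_mul_self (i : ι) : weylGroup.ofIdx P i * weylGroup.ofIdx P i = 1 := by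
  apply Subtype.ext
  change Equiv.reflection P i * Equiv.reflection P i = 1
  rw [mul_eq_one_iff_inv_eq, Equiv.reflection_inv]

lemma ofIdx_inv (i : ι) : (weylGroup.ofIdx P i)⁻¹ = weylGroup.ofIdx P i :=
  inv_eq_of_mul_eq_one_left (ofIdx_mul_self i)

/-- Induction over products of reflections, not only the simple ones. -/
@[elab_as_elim]
lemma weylGroup_induction {p : P.weylGroup → Prop} (one : p 1)
    (refl_mul : ∀ i w, p w → p (weylGroup.ofIdx P i * w)) (w : P.weylGroup) : p w := by
  obtain ⟨w, hw⟩ := w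
  have hw' : w ∈ Submonoid.closure (Set.range (Equiv.reflection P)) := by
    rw [← weylGroup_toSubmonoid]; exact hw
  have key : ∃ h : w ∈ P.weylGroup, p ⟨w, h⟩ := by
    induction hw' using Submonoid.closure_induction_left with
    | one => exact ⟨one_mem _, one⟩
    | mul_left x hx y hy ih =>
      obtain ⟨i, rfl⟩ := hx
      have hy' : y ∈ P.weylGroup := by
        have : y ∈ P.weylGroup.toSubmonoid := by rw [weylGroup_toSubmonoid]; exact hy
        exact this
      obtain ⟨h, h'⟩ := ih hy'
      exact ⟨_, refl_mul i _ h'⟩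
  exact key.2

lemma coroot'_weylGroup_smul (w : P.weylGroup) (i : ι) (v : M) :
    P.coroot' (w • i) (w • v) = P.coroot' i v := by
  induction w using weylGroup_induction with
  | one => simp
  | refl_mul j w ih =>
    rw [mul_smul, mul_smul, ← ih, ofIdx_smul_index]
    have := P.coroot'_reflection (i := j) (j := w • i) (weylGroup.ofIdx P j • w • v)
    rw [← this, weylGroup.ofIdx_smul, Equiv.reflection_smul, P.reflection_same]

lemma weylGroup_ext {w w' : P.weylGroup} (h : ∀ v : M, w • v = w' • v) : w = w' := by
  apply Subtype.ext
  apply Equiv.weightHom_injective P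
  ext v
  exact h v

/-- Conjugating a reflection by `w` gives the reflection in the image of the root under `w`. -/
lemma ofIdx_smul_eq_mul (w : P.weylGroup) (i : ι) :
    weylGroup.ofIdx P (w • i) = w * weylGroup.ofIdx P i * w⁻¹ := by
  refine weylGroup_ext fun v => ?_
  have h : P.coroot' (w • i) v = P.coroot' i (w⁻¹ • v) := by
    rw [← coroot'_weylGroup_smul w i, smul_inv_smul]
  rw [mul_smul, mul_smul, ofIdx_smul_eq, ofIdx_smul_eq, smul_sub, smul_inv_smul, smul_comm,
    ← root_weylGroup_smul, h]

end WeylAction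

/-! ### Positive roots and coroots -/

section Positivity

variable {ι M N : Type*} [Finite ι] [AddCommGroup M] [Module ℝ M] [AddCommGroup N] [Module ℝ N]
  {P : RootPairing ι ℝ M N} [P.IsCrystallographic] [P.IsReduced] (b : P.Base)

lemma isPos_reflectionPerm_self_iff {i : ι} :
    b.IsPos (P.reflectionPerm i i) ↔ ¬ b.IsPos i :=
  IsPos.neg_iff_not b i

lemma isPos_reflectionPerm_iff {i j : ι} (hj : j ∈ b.support) (hij : i ≠ j)
    (hij' : i ≠ P.reflectionPerm j j) : b.IsPos (P.reflectionPerm j i) ↔ b.IsPos i := by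
  refine ⟨fun h => ?_, fun h => h.reflectionPerm hj hij⟩
  have := h.reflectionPerm hj (fun h' => hij' (by rw [← P.reflectionPerm_self j i, h']))
  rwa [P.reflectionPerm_self] at this

/-- A root is positive if and only if its coroot is. -/
lemma isPos_flip_iff (i : ι) : b.flip.IsPos i ↔ b.IsPos i := by
  induction i using b.induction_reflect with
  | h₀ i h => rw [isPos_reflectionPerm_self_iff, ← h]; exact isPos_reflectionPerm_self_iff b.flip
  | h₁ i h => exact iff_of_true (isPos_of_mem_support (b := b.flip) h) (isPos_of_mem_support h)
  | h₂ i j h hj =>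
    by_cases hij : i = j
    · subst hij
      rw [isPos_reflectionPerm_self_iff, ← h]; exact isPos_reflectionPerm_self_iff b.flip
    by_cases hij' : i = P.reflectionPerm j j
    · subst hij'
      rw [P.reflectionPerm_self]
      exact iff_of_true (isPos_of_mem_support (b := b.flip) hj) (isPos_of_mem_support hj)
    rw [isPos_reflectionPerm_iff b hj hij hij', ← h]
    exact isPos_reflectionPerm_iff b.flip hj hij hij'

lemma root_mem_closure_of_isPos {i : ι} (hi : b.IsPos i) :
    P.root i ∈ AddSubmonoid.closure (P.root '' b.support) := by
  refine hi.induction_on_add (p := fun i => P.root i ∈ AddSubmonoid.closure (P.root '' b.support))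
    (fun i h => AddSubmonoid.subset_closure ⟨i, h, rfl⟩) fun i j k hk hi hj => ?_
  rw [hk]
  exact add_mem hi (AddSubmonoid.subset_closure ⟨j, hj, rfl⟩)

/-- Positive coroots are sums of simple coroots, by `root_mem_closure_of_isPos` for the dual root
system. -/
lemma coroot_mem_closure_of_isPos {i : ι} (hi : b.IsPos i) :
    P.coroot i ∈ AddSubmonoid.closure (P.coroot '' b.support) :=
  b.flip.root_mem_closure_of_isPos ((b.isPos_flip_iff i).2 hi)

lemma coroot'_nonneg_of_isPos {v : M} (hv : ∀ k ∈ b.support, 0 ≤ P.coroot' k v) {i : ι}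
    (hi : b.IsPos i) : 0 ≤ P.coroot' i v := by
  have h := b.coroot_mem_closure_of_isPos hi
  change 0 ≤ P.toLinearMap v (P.coroot i)
  generalize P.coroot i = y at h
  induction h using AddSubmonoid.closure_induction with
  | mem x hx => obtain ⟨k, hk, rfl⟩ := hx; exact hv k hk
  | zero => simp
  | add x y _ _ hx hy => rw [map_add]; exact add_nonneg hx hy

lemma coroot'_pos_of_isPos {v : M} (hv : ∀ k ∈ b.support, 0 < P.coroot' k v) {i : ι}
    (hi : b.IsPos i) : 0 < P.coroot' i v := by
  have h := b.coroot_mem_closure_of_isPos hi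
  have h0 : P.coroot i ≠ 0 := P.flip.ne_zero i
  change 0 < P.toLinearMap v (P.coroot i)
  have : P.coroot i = 0 ∨ 0 < P.toLinearMap v (P.coroot i) := by
    clear h0
    generalize P.coroot i = y at h
    induction h using AddSubmonoid.closure_induction with
    | mem x hx => obtain ⟨k, hk, rfl⟩ := hx; exact Or.inr (hv k hk)
    | zero => simp
    | add x y _ _ hx hy =>
      rcases hx with rfl | hx
      · simpa using hy
      rcases hy with rfl | hy
      · simpa using Or.inr hx
      rw [map_add]; exact Or.inr (add_pos hx hy)
  exact this.resolve_left h0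

lemma coroot'_reflectionPerm_self (i : ι) (v : M) :
    P.coroot' (P.reflectionPerm i i) v = - P.coroot' i v := by
  simp

/-- Positivity of a root can be read off from the value of its coroot at any strictly dominant
vector. -/
lemma isPos_iff_coroot'_pos {v : M} (hv : ∀ k ∈ b.support, 0 < P.coroot' k v) (i : ι) :
    b.IsPos i ↔ 0 < P.coroot' i v := by
  refine ⟨fun h => b.coroot'_pos_of_isPos hv h, fun h => ?_⟩
  by_contra h'
  rw [← isPos_reflectionPerm_self_iff] at h'
  have := b.coroot'_pos_of_isPos hv h'
  rw [coroot'_reflectionPerm_self] at this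
  linarith

/-- A vector that is integral at the simple coroots is integral at all coroots. -/
lemma exists_int_coroot' {v : M} (hv : ∀ k ∈ b.support, ∃ z : ℤ, P.coroot' k v = z) (i : ι) :
    ∃ z : ℤ, P.coroot' i v = z := by
  have h := b.coroot_mem_span_int i
  change ∃ z : ℤ, P.toLinearMap v (P.coroot i) = z
  generalize P.coroot i = y at h
  induction h using Submodule.span_induction with
  | mem x hx => obtain ⟨k, hk, rfl⟩ := hx; exact hv k hk
  | zero => exact ⟨0, by simp⟩
  | add x y _ _ hx hy =>
    obtain ⟨p, hp⟩ := hx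
    obtain ⟨q, hq⟩ := hy
    exact ⟨p + q, by rw [map_add, hp, hq]; push_cast; rfl⟩
  | smul a x _ hx =>
    obtain ⟨p, hp⟩ := hx
    exact ⟨a * p, by rw [map_zsmul, hp]; push_cast; rw [zsmul_eq_mul]⟩

end Positivity

/-! ### Length and the exchange condition -/

section Length

variable {ι M N : Type*} [Finite ι] [AddCommGroup M] [Module ℝ M] [AddCommGroup N] [Module ℝ N]
  {P : RootPairing ι ℝ M N} [P.IsCrystallographic] [P.IsReduced] (b : P.Base)

lemma isPos_weylGroup_smul_ofIdx_smul_self (w : P.weylGroup) (i : ι) :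
    b.IsPos (w • weylGroup.ofIdx P i • i) ↔ ¬ b.IsPos (w • i) := by
  have h : w • weylGroup.ofIdx P i • i = P.reflectionPerm (w • i) (w • i) := by
    apply P.root.injective
    rw [root_weylGroup_smul, ofIdx_smul_index, P.root_reflectionPerm, P.root_reflectionPerm,
      P.reflection_apply_self, P.reflection_apply_self, smul_neg, root_weylGroup_smul]
  rw [h, isPos_reflectionPerm_self_iff]

lemma weylLength_one : b.weylLength (1 : P.weylGroup) = 0 := by
  simp [weylLength]

lemma weylLength_ofIdx_mul_le {k : ι} (hk : k ∈ b.support) (w : P.weylGroup) :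
    b.weylLength (weylGroup.ofIdx P k * w) ≤ b.weylLength w + 1 := by
  have hsub : {i : ι | b.IsPos i ∧ ¬ b.IsPos ((weylGroup.ofIdx P k * w) • i)} ⊆
      insert (w⁻¹ • k) {i : ι | b.IsPos i ∧ ¬ b.IsPos (w • i)} := by
    rintro i ⟨hi, hi'⟩
    rw [mul_smul, ofIdx_smul_index] at hi'
    by_cases h : b.IsPos (w • i)
    · left
      by_contra hne
      exact hi' (h.reflectionPerm hk fun h' => hne (by rw [← h', inv_smul_smul]))
    · exact Or.inr ⟨hi, h⟩
  exact (Set.ncard_le_ncard hsub (Set.toFinite _)).trans (Set.ncard_insert_le _ _)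

lemma weylLength_prod_le {L : List ι} (hL : ∀ k ∈ L, k ∈ b.support) :
    b.weylLength (L.map (weylGroup.ofIdx P)).prod ≤ L.length := by
  induction L with
  | nil => simp [weylLength_one]
  | cons k L ih =>
    rw [List.map_cons, List.prod_cons, List.length_cons]
    have := b.weylLength_ofIdx_mul_le (hL k (by simp)) (L.map (weylGroup.ofIdx P)).prod
    have := ih fun j hj => hL j (by simp [hj])
    omega

lemma weylLength_mul_ofIdx_lt {k : ι} (hk : k ∈ b.support) {w : P.weylGroup}
    (hw : ¬ b.IsPos (w • k)) : b.weylLength (w * weylGroup.ofIdx P k) < b.weylLength w := by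
  have hkpos := b.isPos_of_mem_support hk
  rw [weylLength, ← Set.ncard_image_of_injective _ (MulAction.injective (weylGroup.ofIdx P k))]
  refine Set.ncard_lt_ncard (Set.ssubset_iff_of_subset ?_ |>.2 ⟨k, ⟨hkpos, hw⟩, ?_⟩)
    (Set.toFinite _)
  · rintro _ ⟨i, ⟨hi, hi'⟩, rfl⟩
    rw [mul_smul] at hi'
    refine ⟨?_, hi'⟩
    refine hi.reflectionPerm hk fun h => hi' ?_
    subst h
    exact (b.isPos_weylGroup_smul_ofIdx_smul_self w i).2 hw
  · rintro ⟨i, ⟨hi, -⟩, h⟩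
    have h : P.reflectionPerm k i = k := h
    have : i = P.reflectionPerm k k := by
      rw [← P.reflectionPerm_self k i, h]
    rw [this, isPos_reflectionPerm_self_iff] at hi
    exact hi hkpos

/-- The Weyl group is generated by the simple reflections. -/
lemma exists_simple_word (w : P.weylGroup) :
    ∃ L : List ι, (∀ k ∈ L, k ∈ b.support) ∧ w = (L.map (weylGroup.ofIdx P)).prod := by
  have key (i : ι) : ∃ L : List ι, (∀ k ∈ L, k ∈ b.support) ∧
      weylGroup.ofIdx P i = (L.map (weylGroup.ofIdx P)).prod := by
    induction i using b.induction_reflect with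
    | h₀ i h =>
      rwa [← ofIdx_smul_index, ofIdx_smul_eq_mul, mul_assoc, mul_inv_cancel, mul_one]
    | h₁ i h => exact ⟨[i], by simpa using h, by simp⟩
    | h₂ i j h hj =>
      obtain ⟨L, hL, h⟩ := h
      refine ⟨j :: L ++ [j], ?_, ?_⟩
      · simpa using ⟨hj, fun a ha => ha.elim (hL a) fun h => h ▸ hj⟩
      · rw [← ofIdx_smul_index, ofIdx_smul_eq_mul, h, ofIdx_inv]; simp [mul_assoc]
  induction w using weylGroup_induction with
  | one => exact ⟨[], by simp, by simp⟩
  | refl_mul i w ih =>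
    obtain ⟨L, hL, rfl⟩ := ih
    obtain ⟨L', hL', h⟩ := key i
    refine ⟨L' ++ L, ?_, by rw [h]; simp⟩
    intro k hk
    rcases List.mem_append.1 hk with h | h
    exacts [hL' k h, hL k h]

/-- The exchange condition: if the product of a simple word `L` sends a simple root `k` to a
negative root, then appending `k` to `L` has the same effect as deleting one letter of `L`. -/
lemma exists_shorter_word {L : List ι} (hL : ∀ k ∈ L, k ∈ b.support) {k : ι} (hk : k ∈ b.support)
    (h : ¬ b.IsPos ((L.map (weylGroup.ofIdx P)).prod • k)) :
    ∃ L' : List ι, (∀ k ∈ L', k ∈ b.support) ∧ L'.length + 1 = L.length ∧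
      (L.map (weylGroup.ofIdx P)).prod * weylGroup.ofIdx P k =
        (L'.map (weylGroup.ofIdx P)).prod := by
  induction L with
  | nil => exact absurd (b.isPos_of_mem_support hk) (by simpa using h)
  | cons a L ih =>
    have ha : a ∈ b.support := hL a (by simp)
    have hL' : ∀ k ∈ L, k ∈ b.support := fun j hj => hL j (by simp [hj])
    by_cases h1 : b.IsPos ((L.map (weylGroup.ofIdx P)).prod • k)
    · -- the root turns negative at the letter `a`, so it equals the simple root `a` just before
      have h2 : (L.map (weylGroup.ofIdx P)).prod • k = a := by
        by_contra hne
        rw [List.map_cons, List.prod_cons, mul_smul] at h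
        exact h (h1.reflectionPerm ha hne)
      refine ⟨L, hL', rfl, ?_⟩
      have h3 := ofIdx_smul_eq_mul (L.map (weylGroup.ofIdx P)).prod k
      rw [h2] at h3
      rw [List.map_cons, List.prod_cons, h3, inv_mul_cancel_right, mul_assoc, ofIdx_mul_self,
        mul_one]
    · obtain ⟨L', hL1, hL2, hL3⟩ := ih hL' h1
      refine ⟨a :: L', ?_, by simpa using hL2, ?_⟩
      · intro j hj
        rcases List.mem_cons.1 hj with rfl | hj
        exacts [ha, hL1 j hj]
      · rw [List.map_cons, List.prod_cons, List.map_cons, List.prod_cons, mul_assoc, hL3]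

/-- Only the identity keeps all simple roots positive: the last letter of a shortest word for any
other element could be cancelled by the exchange condition. -/
lemma eq_one_of_forall_isPos {w : P.weylGroup} (hw : ∀ k ∈ b.support, b.IsPos (w • k)) :
    w = 1 := by
  classical
  have hex : ∃ n, ∃ L : List ι, (∀ k ∈ L, k ∈ b.support) ∧ L.length = n ∧
      w = (L.map (weylGroup.ofIdx P)).prod := by
    obtain ⟨L, hL, h⟩ := b.exists_simple_word w
    exact ⟨_, L, hL, rfl, h⟩
  obtain ⟨L, hL, hn, hwL⟩ := Nat.find_spec hex
  rcases List.eq_nil_or_concat' L with rfl | ⟨L, k, rfl⟩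
  · simpa using hwL
  have hk : k ∈ b.support := hL k (by simp)
  have hL' : ∀ k ∈ L, k ∈ b.support := fun j hj => hL j (by simp [hj])
  have hprod : w = (L.map (weylGroup.ofIdx P)).prod * weylGroup.ofIdx P k := by
    rw [hwL]; simp
  have hneg : ¬ b.IsPos ((L.map (weylGroup.ofIdx P)).prod • k) := by
    rw [← isPos_weylGroup_smul_ofIdx_smul_self, ← mul_smul, mul_smul _ _ k, ← mul_smul,
      ← hprod]
    exact hw k hk
  obtain ⟨L', hL1, hL2, hL3⟩ := b.exists_shorter_word hL' hk hneg
  have := Nat.find_min' hex ⟨L', hL1, rfl, by rw [hprod, hL3]⟩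
  simp only [List.length_append, List.length_singleton] at hn
  omega

end Length

/-! ### Dominant vectors, self-duality and the two invariants -/

section Cone

variable {ι M N : Type*} [Finite ι] [AddCommGroup M] [Module ℝ M] [AddCommGroup N] [Module ℝ N]
  {P : RootPairing ι ℝ M N} [P.IsRootSystem] [P.IsCrystallographic] [P.IsReduced] (b : P.Base)

lemma root_mem_positiveRootCone {i : ι} (hi : b.IsPos i) : P.root i ∈ b.positiveRootCone :=
  Submodule.subset_span ⟨i, hi, rfl⟩

lemma smul_mem_positiveRootCone {r : ℝ} (hr : 0 ≤ r) {v : M} (hv : v ∈ b.positiveRootCone) :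
    r • v ∈ b.positiveRootCone :=
  b.positiveRootCone.smul_mem hr hv

/-- The cone of the positive roots consists of the vectors with non-negative coordinates with
respect to the simple roots. -/
lemma mem_positiveRootCone_iff {v : M} :
    v ∈ b.positiveRootCone ↔ ∀ k, 0 ≤ b.toWeightBasis.repr v k := by
  constructor
  · intro hv k
    induction hv using Submodule.span_induction with
    | mem x hx =>
      obtain ⟨i, hi, rfl⟩ := hx
      have h := b.root_mem_closure_of_isPos hi
      generalize P.root i = y at h
      induction h using AddSubmonoid.closure_induction with
      | mem x hx =>
        obtain ⟨j, hj, rfl⟩ := hx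
        classical
        rw [show P.root j = P.root (⟨j, hj⟩ : b.support) from rfl, toWeightBasis_repr_root,
          Finsupp.single_apply]
        split_ifs <;> simp
      | zero => simp
      | add x y _ _ hx hy => rw [map_add]; exact add_nonneg hx hy
    | zero => simp
    | add x y _ _ hx hy => rw [map_add]; exact add_nonneg hx hy
    | smul a x _ hx =>
      change 0 ≤ b.toWeightBasis.repr ((a : ℝ) • x) k
      rw [map_smul]; exact mul_nonneg a.2 hx
  · intro h
    rw [← b.toWeightBasis.sum_repr v]
    refine sum_mem fun k _ => b.smul_mem_positiveRootCone (h k) ?_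
    rw [toWeightBasis_apply]
    exact b.root_mem_positiveRootCone (b.isPos_of_mem_support k.2)

/-- A dominant vector exceeds every vector of its Weyl group orbit. The element `w` is shortened by
simple reflections on the right, each of which adds a multiple of the positive root `-w k`. -/
lemma sub_smul_mem_positiveRootCone {v : M} (hv : ∀ k ∈ b.support, 0 ≤ P.coroot' k v)
    (w : P.weylGroup) : v - w • v ∈ b.positiveRootCone := by
  induction hn : b.weylLength w using Nat.strong_induction_on generalizing w with
  | _ n ih =>
    by_cases hw : ∀ k ∈ b.support, b.IsPos (w • k)
    · rw [b.eq_one_of_forall_isPos hw]; simp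
    · push Not at hw
      obtain ⟨k, hk, hneg⟩ := hw
      have h1 := ih _ (hn ▸ b.weylLength_mul_ofIdx_lt hk hneg) (w * weylGroup.ofIdx P k) rfl
      have h2 : P.root (P.reflectionPerm (w • k) (w • k)) ∈ b.positiveRootCone :=
        b.root_mem_positiveRootCone ((b.isPos_reflectionPerm_self_iff).2 hneg)
      have h3 := add_mem h1 (b.smul_mem_positiveRootCone (hv k hk) h2)
      convert h3 using 1
      rw [P.root_reflectionPerm, P.reflection_apply_self, root_weylGroup_smul, mul_smul,
        ofIdx_smul_eq, smul_sub, smul_comm w, smul_neg]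
      abel

/-- Dominant vectors in the same Weyl group orbit are equal. -/
lemma eq_of_dominant_of_smul_eq {v v' : M} (hv : ∀ k ∈ b.support, 0 ≤ P.coroot' k v)
    (hv' : ∀ k ∈ b.support, 0 ≤ P.coroot' k v') {w : P.weylGroup} (h : w • v = v') : v' = v := by
  have h1 := b.sub_smul_mem_positiveRootCone hv w
  have h2 := b.sub_smul_mem_positiveRootCone hv' w⁻¹
  rw [h, mem_positiveRootCone_iff] at h1
  rw [← h, inv_smul_smul, h, mem_positiveRootCone_iff] at h2
  apply b.toWeightBasis.repr.injective
  ext k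
  have := h1 k
  have := h2 k
  simp only [map_sub, Finsupp.sub_apply] at *
  linarith

/-- A vector of the weight space can be prescribed by its values at the simple coroots. -/
lemma exists_coroot'_eq (f : b.support → ℝ) : ∃ v : M, ∀ k : b.support, P.coroot' k v = f k := by
  refine ⟨P.toLinearMap.toPerfPair.symm (b.toCoweightBasis.constr ℝ f), fun k => ?_⟩
  change P.toLinearMap (P.toLinearMap.toPerfPair.symm (b.toCoweightBasis.constr ℝ f))
    (P.coroot k) = f k
  rw [← b.toCoweightBasis_apply, ← b.toCoweightBasis.constr_basis ℝ f k]
  congr 1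
  exact P.toLinearMap.toPerfPair.apply_symm_apply _

/-- The number of positive coroots that are negative at `v`. -/
noncomputable def negCount (v : M) : ℕ := {i : ι | b.IsPos i ∧ P.coroot' i v < 0}.ncard

/-- If `v` is dominant then at most `l(w)` positive coroots are negative at `w v`. This is the
source of all lower bounds for lengths. -/
lemma negCount_smul_le {v : M} (hv : ∀ k ∈ b.support, 0 ≤ P.coroot' k v) (w : P.weylGroup) :
    b.negCount (w • v) ≤ b.weylLength w := by
  let f : ι → ι := fun i => w⁻¹ • P.reflectionPerm i i
  have hf : Function.Injective f := by
    intro i j hij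
    have h := congrArg P.root (MulAction.injective w⁻¹ hij)
    rw [P.root_reflectionPerm, P.root_reflectionPerm, P.reflection_apply_self,
      P.reflection_apply_self, neg_inj] at h
    exact P.root.injective h
  rw [negCount, ← Set.ncard_image_of_injective _ hf]
  refine Set.ncard_le_ncard ?_ (Set.toFinite _)
  rintro _ ⟨i, ⟨hi, hi'⟩, rfl⟩
  refine ⟨?_, ?_⟩
  · by_contra hneg
    rw [← isPos_reflectionPerm_self_iff] at hneg
    have h1 := b.coroot'_nonneg_of_isPos hv hneg
    rw [coroot'_reflectionPerm_self, ← coroot'_weylGroup_smul w, smul_inv_smul,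
      coroot'_reflectionPerm_self] at h1
    linarith
  · simp only [f, smul_inv_smul]
    rwa [isPos_reflectionPerm_self_iff, not_not]

/-- The simple reflection in `k` permutes the positive roots other than `k`, so it removes `k` from
the positive coroots that are negative at `v` and adds none. -/
lemma negCount_ofIdx_smul_lt {k : ι} (hk : k ∈ b.support) {v : M} (hv : P.coroot' k v < 0) :
    b.negCount (weylGroup.ofIdx P k • v) < b.negCount v := by
  have hkpos := b.isPos_of_mem_support hk
  rw [negCount, ← Set.ncard_image_of_injective _ (MulAction.injective (weylGroup.ofIdx P k))]
  refine Set.ncard_lt_ncard (Set.ssubset_iff_of_subset ?_ |>.2 ⟨k, ⟨hkpos, hv⟩, ?_⟩)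
    (Set.toFinite _)
  · rintro _ ⟨i, ⟨hi, hi'⟩, rfl⟩
    rw [← coroot'_weylGroup_smul (weylGroup.ofIdx P k), ← mul_smul, ofIdx_mul_self,
      one_smul] at hi'
    refine ⟨hi.reflectionPerm hk ?_, hi'⟩
    rintro rfl
    rw [ofIdx_smul_index, coroot'_reflectionPerm_self] at hi'
    linarith
  · rintro ⟨i, ⟨hi, -⟩, h⟩
    have h : P.reflectionPerm k i = k := h
    have : i = P.reflectionPerm k k := by
      rw [← P.reflectionPerm_self k i, h]
    rw [this, isPos_reflectionPerm_self_iff] at hi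
    exact hi hkpos

/-- Every Weyl group orbit contains a dominant vector. -/
lemma exists_smul_dominant (v : M) :
    ∃ w : P.weylGroup, ∀ k ∈ b.support, 0 ≤ P.coroot' k (w • v) := by
  induction hn : b.negCount v using Nat.strong_induction_on generalizing v with
  | _ n ih =>
    by_cases h : ∀ k ∈ b.support, 0 ≤ P.coroot' k v
    · exact ⟨1, by simpa using h⟩
    · push Not at h
      obtain ⟨k, hk, hneg⟩ := h
      obtain ⟨w, hw⟩ := ih _ (hn ▸ b.negCount_ofIdx_smul_lt hk hneg) _ rfl
      exact ⟨w * weylGroup.ofIdx P k, by simpa only [mul_smul] using hw⟩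

lemma isLongestElement_iff {w : P.weylGroup} :
    b.IsLongestElement w ↔ ∀ i, b.IsPos i → ¬ b.IsPos (w • i) := by
  constructor
  · intro h i hi
    have := Set.eq_of_subset_of_ncard_le (s := {i : ι | b.IsPos i ∧ ¬ b.IsPos (w • i)})
      (t := {i : ι | b.IsPos i}) (fun i hi => hi.1) (le_of_eq h.symm) (Set.toFinite _)
    have hi' : i ∈ {i : ι | b.IsPos i} := hi
    rw [← this] at hi'
    exact hi'.2
  · intro h
    refine congrArg Set.ncard (Set.ext fun i => ⟨fun hi => hi.1, fun hi => ⟨hi, h i hi⟩⟩)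

/-- A longest element takes the negative of a strictly dominant vector into the dominant chamber. -/
lemma exists_isLongestElement : ∃ w : P.weylGroup, b.IsLongestElement w := by
  obtain ⟨v, hv⟩ := b.exists_coroot'_eq fun _ => 1
  have hv' : ∀ k ∈ b.support, 0 < P.coroot' k v := fun k hk => by
    rw [hv ⟨k, hk⟩]; exact one_pos
  obtain ⟨w, hw⟩ := b.exists_smul_dominant (-v)
  refine ⟨w, b.isLongestElement_iff.2 fun i hi hi' => ?_⟩
  have h1 := b.coroot'_nonneg_of_isPos hw hi'
  rw [coroot'_weylGroup_smul, map_neg] at h1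
  have := b.coroot'_pos_of_isPos hv' hi
  linarith

/-- A dominant weight is self-dual if and only if its negative lies in its Weyl group orbit, because
an orbit contains only one dominant vector. -/
lemma mem_selfDualDominantWeights_iff {v : M} :
    v ∈ b.selfDualDominantWeights ↔ v ∈ b.dominantWeights ∧ ∃ w : P.weylGroup, w • v = -v := by
  constructor
  · rintro ⟨h, w, -, hw⟩
    exact ⟨h, w, by rw [← neg_eq_iff_eq_neg]; exact hw⟩
  · rintro ⟨h, w, hw⟩
    obtain ⟨u, hu⟩ := b.exists_isLongestElement
    refine ⟨h, u, hu, ?_⟩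
    rw [isLongestElement_iff] at hu
    refine b.eq_of_dominant_of_smul_eq h.2 (w := u * w) (fun k hk => ?_) ?_
    · have h1 : ¬ b.IsPos (u⁻¹ • k) := fun h1 =>
        hu _ h1 (by rw [smul_inv_smul]; exact b.isPos_of_mem_support hk)
      rw [← isPos_reflectionPerm_self_iff] at h1
      have h2 := b.coroot'_nonneg_of_isPos h.2 h1
      rwa [coroot'_reflectionPerm_self, ← coroot'_weylGroup_smul u, smul_inv_smul, ← map_neg] at h2
    · rw [mul_smul, hw, smul_neg]

lemma mem_dominantWeights_iff {v : M} :
    v ∈ b.dominantWeights ↔ (∀ k ∈ b.support, ∃ z : ℤ, P.coroot' k v = z) ∧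
      ∀ k ∈ b.support, 0 ≤ P.coroot' k v :=
  ⟨fun h => ⟨fun k _ => h.1 k, h.2⟩, fun h => ⟨b.exists_int_coroot' h.1, h.2⟩⟩

lemma ellInvariant_le {w : P.weylGroup} {v : M} (hv : v ∈ b.dominantWeights)
    (h : w • v ∉ b.positiveRootCone) : b.ellInvariant ≤ b.weylLength w :=
  Nat.sInf_le ⟨w, rfl, fun h' => h (h' v hv)⟩

lemma ellSdInvariant_le {w : P.weylGroup} {v : M} (hv : v ∈ b.selfDualDominantWeights)
    (h : w • v ∉ b.positiveRootCone) : b.ellSdInvariant ≤ b.weylLength w :=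
  Nat.sInf_le ⟨w, rfl, fun h' => h (h' v hv)⟩

/-- A lower bound for `ℓ`. The witnesses `w` and `v` show that the set whose infimum defines `ℓ` is
not empty; the infimum of the empty set would be `0`. -/
lemma le_ellInvariant' {m : ℕ} {w : P.weylGroup} {v : M} (hv : v ∈ b.dominantWeights)
    (h : w • v ∉ b.positiveRootCone) (hm : ∀ (w : P.weylGroup), ∀ v ∈ b.dominantWeights,
      w • v ∉ b.positiveRootCone → m ≤ b.weylLength w) : m ≤ b.ellInvariant := by
  refine le_csInf ⟨_, w, rfl, fun h' => h (h' v hv)⟩ ?_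
  rintro _ ⟨w, rfl, h⟩
  push Not at h
  obtain ⟨v, hv, h⟩ := h
  exact hm w v hv h

lemma le_ellInvariant {m : ℕ} {w : P.weylGroup} {v : M} (hv : v ∈ b.dominantWeights)
    (h : w • v ∉ b.positiveRootCone) (hm : ∀ (w : P.weylGroup), ∀ v ∈ b.dominantWeights,
      w • v ∉ b.positiveRootCone → m ≤ b.negCount (w • v)) : m ≤ b.ellInvariant :=
  b.le_ellInvariant' hv h fun w v hv h => (hm w v hv h).trans (b.negCount_smul_le hv.2 w)

/-- A lower bound for `ℓ` of the self-dual weights; see `le_ellInvariant'` for the role of `w` and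
`v`. -/
lemma le_ellSdInvariant' {m : ℕ} {w : P.weylGroup} {v : M} (hv : v ∈ b.selfDualDominantWeights)
    (h : w • v ∉ b.positiveRootCone) (hm : ∀ (w : P.weylGroup), ∀ v ∈ b.selfDualDominantWeights,
      w • v ∉ b.positiveRootCone → m ≤ b.weylLength w) : m ≤ b.ellSdInvariant := by
  refine le_csInf ⟨_, w, rfl, fun h' => h (h' v hv)⟩ ?_
  rintro _ ⟨w, rfl, h⟩
  push Not at h
  obtain ⟨v, hv, h⟩ := h
  exact hm w v hv h

lemma le_ellSdInvariant {m : ℕ} {w : P.weylGroup} {v : M} (hv : v ∈ b.selfDualDominantWeights)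
    (h : w • v ∉ b.positiveRootCone) (hm : ∀ (w : P.weylGroup), ∀ v ∈ b.selfDualDominantWeights,
      w • v ∉ b.positiveRootCone → m ≤ b.negCount (w • v)) : m ≤ b.ellSdInvariant :=
  b.le_ellSdInvariant' hv h fun w v hv h => (hm w v hv h).trans (b.negCount_smul_le hv.1.2 w)

end Cone

/-! ### Linear realizations of root systems -/

section Realization

variable {ι M N : Type*} [Finite ι] [AddCommGroup M] [Module ℝ M] [AddCommGroup N] [Module ℝ N]
  {P : RootPairing ι ℝ M N} [P.IsRootSystem] [P.IsCrystallographic] [P.IsReduced] (b : P.Base)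

/-- Vectors of the weight space are determined by their values at the simple coroots. -/
lemma ext_coroot' {v v' : M} (h : ∀ k ∈ b.support, P.coroot' k v = P.coroot' k v') : v = v' := by
  apply P.toLinearMap.toPerfPair.injective
  refine b.toCoweightBasis.ext fun k => ?_
  rw [toCoweightBasis_apply]
  exact h k k.2

/-- Distinct functionals given by positive coroots and negative at `v` bound `negCount v` from
below. -/
lemma card_le_negCount {τ : Type*} (S : Finset τ) (F : τ → Module.Dual ℝ M)
    (hinj : Set.InjOn F S) (hF : ∀ t ∈ S, ∃ i, b.IsPos i ∧ P.coroot' i = F t) {v : M}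
    (hv : ∀ t ∈ S, F t v < 0) : S.card ≤ b.negCount v := by
  rcases S.eq_empty_or_nonempty with rfl | ⟨t, ht⟩
  · simp
  have : Nonempty ι := ⟨(hF t ht).choose⟩
  choose! f hf hf' using hF
  rw [negCount, ← Set.ncard_coe_finset S]
  refine Set.ncard_le_ncard_of_injOn f (fun t ht => ⟨hf t ht, ?_⟩) (fun s hs t ht h => ?_)
    (Set.toFinite _)
  · rw [hf' t ht]; exact hv t ht
  · exact hinj hs ht (by rw [← hf' s hs, ← hf' t ht, h])

/-- Coroot functionals are stable under composition with reflections. -/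
lemma exists_coroot'_comp {F : Module.Dual ℝ M} (hF : ∃ i, P.coroot' i = F) (k : ι)
    {F' : Module.Dual ℝ M} (h : ∀ v, F' v = F (weylGroup.ofIdx P k • v)) :
    ∃ i, P.coroot' i = F' := by
  obtain ⟨i, rfl⟩ := hF
  refine ⟨P.reflectionPerm k i, ?_⟩
  ext v
  rw [h, P.coroot'_reflectionPerm]
  rfl

/-- A root system with Cartan matrix `A` can be mapped linearly to any space `V` that contains
vectors `r k` with coroot functionals `f k` and coweight functionals `g k` matching `A`. -/
lemma exists_realization {n : ℕ} {A : Matrix (Fin n) (Fin n) ℤ} {e : b.support ≃ Fin n}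
    (he : ∀ i j : b.support, b.cartanMatrix i j = A (e i) (e j))
    {V : Type*} [AddCommGroup V] [Module ℝ V] (r : Fin n → V) (f g : Fin n → Module.Dual ℝ V)
    (hf : ∀ l k, f k (r l) = A l k) (hg : ∀ k l, g k (r l) = if k = l then 1 else 0) :
    ∃ φ : M →ₗ[ℝ] V, (∀ k v, P.coroot' (e.symm k) v = f k (φ v)) ∧
      (∀ v, v ∈ b.positiveRootCone ↔ ∀ k, 0 ≤ g k (φ v)) ∧
      (∀ k v, φ (weylGroup.ofIdx P (e.symm k : ι) • v) = φ v - f k (φ v) • r k) ∧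
      (∀ y, ∃ v, ∀ k, f k (φ v) = f k y) ∧
      ∀ h : Module.Dual ℝ V, (∀ k, h (r k) = 0) → ∀ v, h (φ v) = 0 := by
  have hφ : ∀ k, b.toWeightBasis.constr ℝ (fun k => r (e k)) (P.root (e.symm k : ι)) = r k :=
    fun k => by rw [← toWeightBasis_apply, Module.Basis.constr_basis, e.apply_symm_apply]
  set φ := b.toWeightBasis.constr ℝ (fun k => r (e k)) with hφdef
  have hcor : ∀ k v, P.coroot' (e.symm k) v = f k (φ v) := by
    intro k v
    have : P.coroot' (e.symm k) = f k ∘ₗ φ := by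
      refine b.toWeightBasis.ext fun i => ?_
      rw [LinearMap.comp_apply, hφdef, Module.Basis.constr_basis, hf, toWeightBasis_apply,
        root_coroot'_eq_pairing, ← P.algebraMap_pairingIn ℤ]
      have := he i (e.symm k)
      rw [e.apply_symm_apply] at this
      rw [← this]
      rfl
    rw [this]; rfl
  refine ⟨φ, hcor, fun v => ?_, fun k v => ?_, fun y => ?_, fun h hh v => ?_⟩
  · have hrep : ∀ k, b.toWeightBasis.repr v (e.symm k) = g k (φ v) := by
      intro k
      have : b.toWeightBasis.coord (e.symm k) = g k ∘ₗ φ := by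
        classical
        refine b.toWeightBasis.ext fun i => ?_
        rw [LinearMap.comp_apply, hφdef, Module.Basis.constr_basis, hg,
          Module.Basis.coord_apply, Module.Basis.repr_self, Finsupp.single_apply]
        congr 1
        rw [eq_iff_iff, e.eq_symm_apply]
        exact eq_comm
      exact congrArg (fun F => F v) this
    rw [mem_positiveRootCone_iff]
    refine ⟨fun h k => ?_, fun h k => ?_⟩
    · rw [← hrep]; exact h _
    · have := h (e k)
      rwa [← hrep, e.symm_apply_apply] at this
  · rw [ofIdx_smul_eq, map_sub, map_smul, hφ, hcor]
  · obtain ⟨v, hv⟩ := b.exists_coroot'_eq fun i => f (e i) y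
    refine ⟨v, fun k => ?_⟩
    rw [← hcor, hv, e.apply_symm_apply]
  · have : h ∘ₗ φ = 0 := by
      refine b.toWeightBasis.ext fun i => ?_
      rw [LinearMap.comp_apply, hφdef, Module.Basis.constr_basis, hh]; rfl
    exact LinearMap.congr_fun this v

/-- Coordinates `φ v 0, …, φ v (m - 1)` on the weight space in which the simple reflections include
the transpositions of neighbouring coordinates, with coroots the differences of these
coordinates. -/
def IsChainRealization (φ : M →ₗ[ℝ] (ℕ → ℝ)) (m : ℕ) : Prop :=
  ∀ k, k + 1 < m → ∃ i ∈ b.support, (∀ v, P.coroot' i v = φ v k - φ v (k + 1)) ∧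
    ∀ v a, φ (weylGroup.ofIdx P i • v) a = φ v (Equiv.swap k (k + 1) a)

/-- The functional `φ v a + s * φ v c`. -/
noncomputable def coordSum (φ : M →ₗ[ℝ] (ℕ → ℝ)) (s : ℝ) (a c : ℕ) : Module.Dual ℝ M :=
  LinearMap.proj a ∘ₗ φ + s • (LinearMap.proj c ∘ₗ φ)

lemma coordSum_apply (φ : M →ₗ[ℝ] (ℕ → ℝ)) (s : ℝ) (a c : ℕ) (v : M) :
    coordSum φ s a c v = φ v a + s * φ v c := rfl

variable {b}

lemma swap_of_lt {k a : ℕ} (h : a < k) : Equiv.swap k (k + 1) a = a :=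
  Equiv.swap_apply_of_ne_of_ne (by omega) (by omega)

lemma swap_of_gt {k a : ℕ} (h : k + 1 < a) : Equiv.swap k (k + 1) a = a :=
  Equiv.swap_apply_of_ne_of_ne (by omega) (by omega)

namespace IsChainRealization

variable {φ : M →ₗ[ℝ] (ℕ → ℝ)} {m : ℕ}

lemma exists_coroot'_eq_sub (h : b.IsChainRealization φ m) {a c : ℕ} (hac : a < c) (hc : c < m) :
    ∃ i, P.coroot' i = coordSum φ (-1) a c := by
  induction c, hac using Nat.le_induction with
  | base =>
    obtain ⟨i, -, hi, -⟩ := h a hc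
    refine ⟨i, ?_⟩
    ext v
    rw [hi, coordSum_apply]; ring
  | succ c hac ih =>
    obtain ⟨i, -, -, hi⟩ := h c hc
    refine exists_coroot'_comp (ih (by omega)) i fun v => ?_
    rw [coordSum_apply, coordSum_apply, hi, hi, swap_of_lt (by omega), Equiv.swap_apply_left]

/-- If the sum of the last two coordinates is a coroot then so are all sums of two coordinates. -/
lemma exists_coroot'_eq_add (h : b.IsChainRealization φ (m + 2))
    (hlast : ∃ i, P.coroot' i = coordSum φ 1 m (m + 1)) {a c : ℕ} (hac : a < c)
    (hc : c < m + 2) : ∃ i, P.coroot' i = coordSum φ 1 a c := by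
  have hstep : ∀ a ≤ m, ∃ i, P.coroot' i = coordSum φ 1 a (m + 1) := by
    intro a ha
    induction ha using Nat.decreasingInduction with
    | self => exact hlast
    | of_succ a ha ih =>
      obtain ⟨i, -, -, hi⟩ := h a (by omega)
      refine exists_coroot'_comp ih i fun v => ?_
      rw [coordSum_apply, coordSum_apply, hi, hi, Equiv.swap_apply_right, swap_of_gt (by omega)]
  have hc' : c ≤ m + 1 := by omega
  induction hc' using Nat.decreasingInduction with
  | self => exact hstep a (by omega)
  | of_succ c hcm ih =>
    obtain ⟨i, -, -, hi⟩ := h c (by omega)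
    refine exists_coroot'_comp (ih (by omega) (by omega)) i fun v => ?_
    rw [coordSum_apply, coordSum_apply, hi, hi, Equiv.swap_apply_right, swap_of_lt (by omega)]

/-- The coordinate with index `q` is moved to the front by a product of `q` simple reflections. -/
lemma exists_word_apply_zero (h : b.IsChainRealization φ m) {q : ℕ} (hq : q < m) :
    ∃ w : P.weylGroup, b.weylLength w ≤ q ∧ ∀ v, φ (w • v) 0 = φ v q := by
  suffices ∃ L : List ι, (∀ k ∈ L, k ∈ b.support) ∧ L.length = q ∧
      ∀ v, φ ((L.map (weylGroup.ofIdx P)).prod • v) 0 = φ v q by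
    obtain ⟨L, hL, rfl, h⟩ := this
    exact ⟨_, b.weylLength_prod_le hL, h⟩
  induction q with
  | zero => exact ⟨[], by simp, rfl, by simp⟩
  | succ q ih =>
    obtain ⟨L, hL, hlen, hL'⟩ := ih (by omega)
    obtain ⟨i, hi, -, hi'⟩ := h q hq
    refine ⟨L ++ [i], ?_, by simp [hlen], fun v => ?_⟩
    · intro k hk
      rcases List.mem_append.1 hk with hk | hk
      · exact hL k hk
      · rw [List.mem_singleton.1 hk]; exact hi
    · simp only [List.map_append, List.map_cons, List.map_nil, List.prod_append,
        List.prod_singleton]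
      rw [mul_smul, hL', hi', Equiv.swap_apply_left]

/-- The first coordinate vector is moved to the `j`-th one by a product of `j` simple
reflections. -/
lemma exists_word_single (h : b.IsChainRealization φ m) {v : M}
    (hv : ∀ a < m, φ v a = if a = 0 then 1 else 0) {j : ℕ} (hj : j < m) :
    ∃ w : P.weylGroup, b.weylLength w ≤ j ∧ ∀ a < m, φ (w • v) a = if a = j then 1 else 0 := by
  induction j with
  | zero => exact ⟨1, by simp [weylLength_one], by simpa using hv⟩
  | succ j ih =>
    obtain ⟨w, hw, hw'⟩ := ih (by omega)
    obtain ⟨i, hi, -, hi'⟩ := h j hj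
    refine ⟨weylGroup.ofIdx P i * w, (b.weylLength_ofIdx_mul_le hi w).trans (by omega),
      fun a ha => ?_⟩
    rw [mul_smul, hi', hw']
    · congr 1
      rw [eq_iff_iff, Equiv.swap_apply_eq_iff, Equiv.swap_apply_left]
    · rw [Equiv.swap_apply_def]; split_ifs <;> omega

/-- Every permutation of the coordinates is induced by a Weyl group element. -/
lemma exists_perm {n : ℕ} (h : b.IsChainRealization φ (n + 1)) (σ : Equiv.Perm (Fin (n + 1))) :
    ∃ w : P.weylGroup, ∀ v (a : Fin (n + 1)), φ (w • v) a = φ v (σ a) := by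
  have hσ : σ ∈ Submonoid.closure
      (Set.range fun i : Fin n => Equiv.swap i.castSucc i.succ) := by
    rw [Equiv.Perm.mclosure_swap_castSucc_succ]; trivial
  induction hσ using Submonoid.closure_induction with
  | mem x hx =>
    obtain ⟨k, rfl⟩ := hx
    obtain ⟨i, -, -, hi⟩ := h k (by omega)
    refine ⟨weylGroup.ofIdx P i, fun v a => ?_⟩
    rw [hi]
    simp only [Equiv.swap_apply_def, Fin.ext_iff, Fin.val_castSucc, Fin.val_succ]
    split_ifs <;> simp
  | one => exact ⟨1, by simp⟩
  | mul x y _ _ hx hy =>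
    obtain ⟨w, hw⟩ := hx
    obtain ⟨u, hu⟩ := hy
    refine ⟨u * w, fun v a => ?_⟩
    rw [mul_smul, hu, hw, Equiv.Perm.mul_apply]

end IsChainRealization

end Realization

/-! ### Negative partial sums -/

section Combinatorics

open Finset

/-- The involution `a ↦ t - a` of the residues modulo `j`, represented by the numbers below `j`. -/
def residueSub (j t a : ℕ) : ℕ := if a ≤ t then t - a else t + j - a

/-- If the sum of `x` over the residues modulo `j` is negative then so is the value of `x` at some
pair of residues adding up to `t`. -/
lemma exists_add_residueSub_neg {x : ℕ → ℝ} {j t : ℕ} (ht : t < j)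
    (hx : ∑ a ∈ range j, x a < 0) : ∃ a < j, x a + x (residueSub j t a) < 0 := by
  have hmaps : ∀ a ∈ range j, residueSub j t a ∈ range j := by
    intro a ha
    rw [mem_range, residueSub] at *
    split_ifs <;> omega
  have hinv : ∀ a ∈ range j, residueSub j t (residueSub j t a) = a := by
    intro a ha
    rw [mem_range] at ha
    unfold residueSub
    split_ifs <;> omega
  have hsum : ∑ a ∈ range j, x (residueSub j t a) = ∑ a ∈ range j, x a :=
    sum_nbij' (residueSub j t) (residueSub j t) hmaps hmaps hinv hinv fun a _ => rfl
  have h : ∑ a ∈ range j, (x a + x (residueSub j t a)) < ∑ a ∈ range j, (0 : ℝ) := by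
    rw [sum_add_distrib, hsum, sum_const_zero]; linarith
  obtain ⟨a, ha, h⟩ := exists_lt_of_sum_lt h
  exact ⟨a, mem_range.1 ha, h⟩

lemma exists_residue_pair {x : ℕ → ℝ} {j t : ℕ} (ht : t < j)
    (hx : ∑ a ∈ range j, x a < 0) : ∃ a c, a ≤ c ∧ c < j ∧ (a + c) % j = t ∧ x a + x c < 0 := by
  obtain ⟨a, ha, h⟩ := exists_add_residueSub_neg ht hx
  have h1 : residueSub j t a < j := by unfold residueSub; split_ifs <;> omega
  have h2 : (a + residueSub j t a) % j = t := by
    unfold residueSub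
    split_ifs with h'
    · rw [Nat.add_sub_cancel' h', Nat.mod_eq_of_lt ht]
    · rw [show a + (t + j - a) = t + j by omega, Nat.add_mod_right, Nat.mod_eq_of_lt ht]
  rcases le_total a (residueSub j t a) with h3 | h3
  · exact ⟨_, _, h3, h1, h2, h⟩
  · exact ⟨_, _, h3, ha, by rw [add_comm, h2], by rw [add_comm]; exact h⟩

/-- If a sum of reals over a set of `c` elements is negative then so are many of the pairwise sums:
at least `c - 1` unless `c` is `3` or `5`. Ordered pairs are counted, so each pair counts twice.
Either the smallest term forms a negative sum with all other terms, or the smallest and the largest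
term are removed; the smallest forms negative sums with more than half of the remaining terms. -/
lemma card_neg_pairs_ge {α : Type*} [DecidableEq α] (x : α → ℝ) (s : Finset α)
    (hs : ∑ a ∈ s, x a < 0) :
    2 * (if s.card = 3 then 1 else if s.card = 5 then 3 else s.card - 1) ≤
      (s.offDiag.filter fun p => x p.1 + x p.2 < 0).card := by
  induction hc : s.card using Nat.strong_induction_on generalizing s with
  | _ c ih =>
    have hne : s.Nonempty := by
      rw [nonempty_iff_ne_empty]; rintro rfl; simp at hs
    obtain ⟨a, ha, hamin⟩ := s.exists_min_image x hne
    have haneg : x a < 0 := by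
      by_contra h
      exact absurd hs (not_lt.2 (sum_nonneg fun i hi => (not_lt.1 h).trans (hamin i hi)))
    -- the pairs formed by the smallest value `x a` and the elements of `u`
    have hpairs : ∀ u ⊆ s, a ∉ u → (∀ i ∈ u, x a + x i < 0) →
        ∀ s' ⊆ s, a ∉ s' → 2 * u.card + (s'.offDiag.filter fun p => x p.1 + x p.2 < 0).card ≤
          (s.offDiag.filter fun p => x p.1 + x p.2 < 0).card := by
      intro u hu hau hneg s' hs' has'
      have h1 : Disjoint (u.image fun i => (a, i)) (u.image fun i => (i, a)) := by
        rw [disjoint_left]; intro p hp hp'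
        simp only [mem_image] at hp hp'
        obtain ⟨i, hi, rfl⟩ := hp
        obtain ⟨k, hk, h⟩ := hp'
        exact ne_of_mem_of_not_mem hk hau (Prod.ext_iff.1 h).1
      have h2 : Disjoint ((u.image fun i => (a, i)) ∪ (u.image fun i => (i, a)))
          (s'.offDiag.filter fun p => x p.1 + x p.2 < 0) := by
        rw [disjoint_left]; intro p hp hp'
        simp only [mem_union, mem_image, mem_filter, mem_offDiag] at hp hp'
        obtain ⟨i, hi, rfl⟩ | ⟨i, hi, rfl⟩ := hp
        exacts [has' hp'.1.1, has' hp'.1.2.1]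
      have h3 := card_union_of_disjoint h2
      rw [card_union_of_disjoint h1, card_image_of_injective _ (fun i k h => (Prod.ext_iff.1 h).2),
        card_image_of_injective _ (fun i k h => (Prod.ext_iff.1 h).1)] at h3
      rw [two_mul, ← h3]
      refine card_le_card fun p hp => ?_
      simp only [mem_union, mem_image, mem_filter, mem_offDiag] at hp ⊢
      obtain (⟨i, hi, rfl⟩ | ⟨i, hi, rfl⟩) | ⟨⟨h1, h2, h3⟩, h4⟩ := hp
      · exact ⟨⟨ha, hu hi, (ne_of_mem_of_not_mem hi hau).symm⟩, hneg i hi⟩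
      · exact ⟨⟨hu hi, ha, ne_of_mem_of_not_mem hi hau⟩, by rw [add_comm]; exact hneg i hi⟩
      · exact ⟨⟨hs' h1, hs' h2, h3⟩, h4⟩
    obtain ⟨d, hd, hdmax⟩ := s.exists_max_image x hne
    rcases lt_or_ge (x a + x d) 0 with h | h
    · have := hpairs (s.erase a) (erase_subset _ _) (by simp)
        (fun i hi => lt_of_le_of_lt (by linarith [hdmax i (mem_of_mem_erase hi)]) h) ∅ (by simp)
        (by simp)
      rw [card_erase_of_mem ha, hc] at this
      split_ifs <;> omega
    · have had : a ≠ d := by rintro rfl; linarith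
      set s' := (s.erase a).erase d with hs'
      have hd' : d ∈ s.erase a := mem_erase.2 ⟨had.symm, hd⟩
      have hsub : s' ⊆ s := (erase_subset _ _).trans (erase_subset _ _)
      have has' : a ∉ s' := by simp [hs']
      have hcard : s'.card + 2 = c := by
        have h1 := card_erase_add_one hd'
        have h2 := card_erase_add_one ha
        rw [← hs'] at h1
        omega
      have hsum : ∑ i ∈ s', x i < 0 := by
        have h1 := add_sum_erase _ x hd'
        have h2 := add_sum_erase _ x ha
        linarith
      have hrec := ih s'.card (by omega) s' hsum rfl
      set u := s'.filter fun i => x a + x i < 0 with hu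
      have hmain := hpairs u ((filter_subset _ _).trans hsub) (fun h => has' (mem_filter.1 h).1)
        (fun i hi => (mem_filter.1 hi).2) s' hsub has'
      -- otherwise the values of at least `- x a` outweigh those of at least `x a`
      have hucard : s'.card < 2 * u.card := by
        by_contra hle
        have h1 : ∑ i ∈ s', (if x a + x i < 0 then x a else - x a) ≤ ∑ i ∈ s', x i := by
          refine sum_le_sum fun i hi => ?_
          split_ifs with h
          · exact hamin i (hsub hi)
          · linarith
        rw [sum_ite, sum_const, sum_const, ← hu, nsmul_eq_mul, nsmul_eq_mul] at h1
        have h2 : (u.card : ℝ) ≤ (s'.filter fun i => ¬ x a + x i < 0).card := by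
          have := card_filter_add_card_filter_not (s := s') fun i => x a + x i < 0
          rw [← hu] at this
          exact_mod_cast (by omega)
        nlinarith
      split_ifs at hrec ⊢ <;> omega

/-- The bound of `card_neg_pairs_ge` for unordered pairs of natural numbers. -/
lemma card_neg_pairs_ge' (x : ℕ → ℝ) (s : Finset ℕ) (hs : ∑ a ∈ s, x a < 0) :
    (if s.card = 3 then 1 else if s.card = 5 then 3 else s.card - 1) ≤
      ((s ×ˢ s).filter fun p => p.1 < p.2 ∧ x p.1 + x p.2 < 0).card := by
  have h := card_neg_pairs_ge x s hs
  have h1 : (s.offDiag.filter fun p => x p.1 + x p.2 < 0).card ≤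
      ((s ×ˢ s).filter fun p => p.1 < p.2 ∧ x p.1 + x p.2 < 0).card +
      (((s ×ˢ s).filter fun p => p.1 < p.2 ∧ x p.1 + x p.2 < 0).image Prod.swap).card := by
    refine le_trans (card_le_card fun p hp => ?_) (card_union_le _ _)
    simp only [mem_union, mem_image, mem_filter, mem_offDiag, mem_product] at hp ⊢
    obtain ⟨⟨h1, h2, h3⟩, h4⟩ := hp
    rcases lt_or_gt_of_ne h3 with h5 | h5
    · exact Or.inl ⟨⟨h1, h2⟩, h5, h4⟩
    · exact Or.inr ⟨p.swap, ⟨⟨h2, h1⟩, h5, by rw [add_comm]; exact h4⟩, p.swap_swap⟩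
  have h2 := card_image_le (s := (s ×ˢ s).filter fun p => p.1 < p.2 ∧ x p.1 + x p.2 < 0)
    (f := Prod.swap)
  omega

/-- If a sum is negative then some threshold is exceeded by more of the negative terms than of the
positive ones: otherwise the terms can be matched so that every negative term is compensated. -/
lemma exists_threshold {α : Type*} [DecidableEq α] (x : α → ℝ) (s : Finset α)
    (hs : ∑ a ∈ s, x a < 0) :
    ∃ t : ℝ, 0 ≤ t ∧ (s.filter fun a => t < x a).card < (s.filter fun a => x a < -t).card := by
  by_contra! hle
  suffices 0 ≤ ∑ a ∈ s, x a by linarith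
  clear hs
  induction hc : s.card using Nat.strong_induction_on generalizing s with
  | _ c ih =>
    by_cases hpos : ∀ a ∈ s, 0 ≤ x a
    · exact sum_nonneg hpos
    push Not at hpos
    obtain ⟨a₀, ha₀, ha₀neg⟩ := hpos
    obtain ⟨a, ha, hamin⟩ := s.exists_min_image x ⟨a₀, ha₀⟩
    obtain ⟨d, hd, hdmax⟩ := s.exists_max_image x ⟨a₀, ha₀⟩
    have haneg : x a < 0 := (hamin a₀ ha₀).trans_lt ha₀neg
    -- the largest term compensates for the smallest one
    have hda : - x a ≤ x d := by
      by_contra! hlt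
      have h1 := hle (max 0 (x d)) (le_max_left _ _)
      have h2 : s.filter (fun i => max 0 (x d) < x i) = ∅ :=
        filter_eq_empty_iff.2 fun i hi h =>
          absurd (hdmax i hi) (not_le.2 ((le_max_right _ _).trans_lt h))
      rw [h2, card_empty, Nat.le_zero, card_eq_zero, filter_eq_empty_iff] at h1
      exact h1 ha (by rw [lt_neg]; exact max_lt (by linarith) hlt)
    have had : a ≠ d := by rintro rfl; linarith
    have hd' : d ∈ s.erase a := mem_erase.2 ⟨had.symm, hd⟩
    have h1 := card_erase_add_one hd'
    have h2 := card_erase_add_one ha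
    have h3 := add_sum_erase _ x hd'
    have h4 := add_sum_erase _ x ha
    have := ih ((s.erase a).erase d).card (by omega) ((s.erase a).erase d) (fun t ht => ?_) rfl
    · linarith
    · rcases lt_or_ge t (- x a) with hta | hta
      · have h5 := hle t ht
        have h6 : a ∈ s.filter fun i => x i < -t := mem_filter.2 ⟨ha, by linarith⟩
        have h7 : d ∈ s.filter fun i => t < x i := mem_filter.2 ⟨hd, by linarith⟩
        have h8 : ((s.erase a).erase d).filter (fun i => x i < -t) =
            (s.filter fun i => x i < -t).erase a := by
          ext i
          simp only [mem_filter, mem_erase]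
          refine ⟨fun h => ⟨h.1.2.1, h.1.2.2, h.2⟩, fun h => ⟨⟨?_, h.1, h.2.1⟩, h.2.2⟩⟩
          rintro rfl; linarith [h.2.2]
        have h9 : ((s.erase a).erase d).filter (fun i => t < x i) =
            (s.filter fun i => t < x i).erase d := by
          ext i
          simp only [mem_filter, mem_erase]
          refine ⟨fun h => ⟨h.1.1, h.1.2.2, h.2⟩, fun h => ⟨⟨h.1, ?_, h.2.1⟩, h.2.2⟩⟩
          rintro rfl; linarith [h.2.2]
        rw [h8, h9, card_erase_of_mem h6, card_erase_of_mem h7]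
        omega
      · have h5 : ((s.erase a).erase d).filter (fun i => x i < -t) = ∅ := by
          refine filter_eq_empty_iff.2 fun i hi h => ?_
          have := hamin i (mem_of_mem_erase (mem_of_mem_erase hi))
          linarith
        rw [h5]; simp

/-- For `m` values that are symmetric about `0`, if the sum of the first `j` is negative then there
are at least `(m + 1) / 2` pairs of one of the first `j` values and a larger value after these. With
a threshold `t` as in `exists_threshold`, it suffices to count the pairs in which the first value is
below `-t` and the second is not, or the second is above `t` and the first is not. -/
lemma le_card_lt_pairs_of_symm {x : ℕ → ℝ} {m j : ℕ} (hj : j ≤ m)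
    (hsymm : ∀ t : ℝ, ((range m).filter fun a => t < x a).card =
      ((range m).filter fun a => x a < -t).card)
    (hx : ∑ a ∈ range j, x a < 0) :
    (m + 1) / 2 ≤ ((range j ×ˢ Ico j m).filter fun p => x p.1 < x p.2).card := by
  obtain ⟨t, ht, hlt⟩ := exists_threshold x (range j) hx
  have hsplit (p : ℕ → Prop) [DecidablePred p] : ((range m).filter p).card =
      ((range j).filter p).card + ((Ico j m).filter p).card := by
    have h1 : range m = range j ∪ Ico j m := by ext a; simp; omega
    have h2 : Disjoint (range j) (Ico j m) := by
      rw [disjoint_left]; intro a; simp; omega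
    rw [h1, filter_union, card_union_of_disjoint (disjoint_filter_filter h2)]
  have hsym := hsymm t
  rw [hsplit, hsplit] at hsym
  have htot (s : Finset ℕ) : s.card = (s.filter fun a => t < x a).card +
      (s.filter fun a => x a < -t).card + (s.filter fun a => ¬ x a < -t ∧ ¬ t < x a).card := by
    rw [← card_filter_add_card_filter_not (s := s) fun a => x a < -t,
      ← card_filter_add_card_filter_not (s := s.filter fun a => ¬ x a < -t) fun a => t < x a,
      filter_filter, filter_filter]
    have : s.filter (fun a => ¬ x a < -t ∧ t < x a) = s.filter fun a => t < x a :=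
      filter_congr fun a _ => ⟨fun h => h.2, fun h => ⟨by linarith, h⟩⟩
    rw [this]; omega
  have h1 := htot (range j)
  have h2 := htot (Ico j m)
  rw [card_range] at h1
  rw [Nat.card_Ico] at h2
  have hcount : ((range j).filter fun a => x a < -t).card *
      ((Ico j m).filter fun a => t < x a).card + ((range j).filter fun a => x a < -t).card *
      ((Ico j m).filter fun a => ¬ x a < -t ∧ ¬ t < x a).card +
      ((range j).filter fun a => ¬ x a < -t ∧ ¬ t < x a).card *
      ((Ico j m).filter fun a => t < x a).card ≤
      ((range j ×ˢ Ico j m).filter fun p => x p.1 < x p.2).card := by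
    rw [← card_product, ← card_product, ← card_product, ← card_union_of_disjoint,
      ← card_union_of_disjoint]
    · refine card_le_card fun p hp => ?_
      simp only [mem_union, mem_product, mem_filter, not_lt] at hp ⊢
      rcases hp with (⟨⟨h1, h2⟩, h3, h4⟩ | ⟨⟨h1, h2⟩, h3, h4, h5⟩) | ⟨⟨h1, h2, h3⟩, h4, h5⟩
      · exact ⟨⟨h1, h3⟩, by linarith⟩
      · exact ⟨⟨h1, h3⟩, by linarith⟩
      · exact ⟨⟨h1, h4⟩, by linarith⟩
    · rw [disjoint_left]; intro p hp hp'
      simp only [mem_union, mem_product, mem_filter] at hp hp'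
      rcases hp with hp | hp
      · exact hp'.1.2.1 hp.1.2
      · exact hp'.1.2.1 hp.1.2
    · rw [disjoint_left]; intro p hp hp'
      simp only [mem_product, mem_filter] at hp hp'
      exact hp'.2.2.2 hp.2.2
  refine le_trans ?_ hcount
  generalize ((range j).filter fun a => t < x a).card = p at *
  generalize ((range j).filter fun a => x a < -t).card = q at *
  generalize ((range j).filter fun a => ¬ x a < -t ∧ ¬ t < x a).card = z at *
  generalize ((Ico j m).filter fun a => t < x a).card = p' at *
  generalize ((Ico j m).filter fun a => x a < -t).card = q' at *
  generalize ((Ico j m).filter fun a => ¬ x a < -t ∧ ¬ t < x a).card = z' at *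
  obtain ⟨q, rfl⟩ : ∃ r, q = r + 1 := ⟨q - 1, by omega⟩
  obtain ⟨p', rfl⟩ : ∃ r, p' = r + 1 := ⟨p' - 1, by omega⟩
  have e1 : (q + 1) * (p' + 1) = q * p' + q + p' + 1 := by ring
  have e2 : (q + 1) * z' = q * z' + z' := by ring
  have e3 : z * (p' + 1) = z * p' + z := by ring
  rw [e1, e2, e3]
  omega

end Combinatorics

/-! ### Coordinates for the types A, B and C -/

section Classical

open Finset

/-- The sum of the first `k` coordinates. -/
noncomputable def prefixSum (k : ℕ) : Module.Dual ℝ (ℕ → ℝ) := ∑ a ∈ range k, LinearMap.proj a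

lemma prefixSum_apply (k : ℕ) (x : ℕ → ℝ) : prefixSum k x = ∑ a ∈ range k, x a := by
  simp [prefixSum]

lemma prefixSum_single (k a : ℕ) : prefixSum k (Pi.single a 1) = if a < k then 1 else 0 := by
  rw [prefixSum_apply, sum_pi_single']; simp

/-- The difference of two neighbouring coordinate vectors. -/
noncomputable def diffVec (k : ℕ) : ℕ → ℝ := Pi.single k 1 - Pi.single (k + 1) 1

/-- The difference of two neighbouring coordinates. -/
noncomputable def diffFun (k : ℕ) : Module.Dual ℝ (ℕ → ℝ) :=
  (LinearMap.proj k : (ℕ → ℝ) →ₗ[ℝ] ℝ) - LinearMap.proj (k + 1)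

lemma diffFun_apply (k : ℕ) (x : ℕ → ℝ) : diffFun k x = x k - x (k + 1) := rfl

lemma prefixSum_diffVec (k l : ℕ) :
    prefixSum (k + 1) (diffVec l) = if k = l then 1 else 0 := by
  rw [diffVec, map_sub, prefixSum_single, prefixSum_single]
  split_ifs <;> first | omega | norm_num

lemma sub_diffFun_smul_diffVec (x : ℕ → ℝ) (k a : ℕ) :
    (x - diffFun k x • diffVec k) a = x (Equiv.swap k (k + 1) a) := by
  simp only [diffFun_apply, diffVec, Pi.sub_apply, Pi.smul_apply, smul_eq_mul, Pi.single_apply,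
    Equiv.swap_apply_def]
  split_ifs <;> subst_vars <;> first | omega | ring

lemma eq_of_forall_succ_eq {z : ℕ → ℝ} {m : ℕ} (h : ∀ k, k < m → z k = z (k + 1)) :
    ∀ a ≤ m, z a = z m := by
  intro a ha
  induction ha using Nat.decreasingInduction with
  | self => rfl
  | of_succ k hk ih => rw [h k hk, ih]

variable {ι M N : Type*} [Finite ι] [AddCommGroup M] [Module ℝ M] [AddCommGroup N] [Module ℝ N]
  {P : RootPairing ι ℝ M N} [P.IsRootSystem] [P.IsCrystallographic] [P.IsReduced] {b : P.Base}

/-- Coordinates with vanishing sum for a root system of type `A`. -/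
lemma HasCartanType.exists_realization_A {n : ℕ} (h : b.HasCartanType (CartanMatrix.A n)) :
    ∃ φ : M →ₗ[ℝ] (ℕ → ℝ), b.IsChainRealization φ (n + 1) ∧
      (∀ v, v ∈ b.positiveRootCone ↔ ∀ k < n, 0 ≤ ∑ a ∈ range (k + 1), φ v a) ∧
      (∀ i ∈ b.support, ∃ k < n, (∀ v, P.coroot' i v = φ v k - φ v (k + 1)) ∧
        ∀ v a, φ (weylGroup.ofIdx P i • v) a = φ v (Equiv.swap k (k + 1) a)) ∧
      (∀ v, ∑ a ∈ range (n + 1), φ v a = 0) ∧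
      ∀ y : ℕ → ℝ, ∑ a ∈ range (n + 1), y a = 0 → ∃ v, ∀ a < n + 1, φ v a = y a := by
  obtain ⟨e, he⟩ := h
  obtain ⟨φ, h1, h2, h3, h4, h5⟩ := b.exists_realization he (fun k => diffVec k)
    (fun k => diffFun k) (fun k => prefixSum (k + 1))
    (fun l k => by
      simp only [diffFun_apply, diffVec, CartanMatrix.A, Matrix.of_apply, Pi.sub_apply,
        Pi.single_apply, Fin.ext_iff]
      split_ifs <;> first | omega | norm_num)
    (fun k l => by rw [prefixSum_diffVec]; simp [Fin.ext_iff])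
  have h6 : ∀ v, ∑ a ∈ range (n + 1), φ v a = 0 := fun v => by
    rw [← prefixSum_apply]
    refine h5 _ (fun k => ?_) v
    rw [prefixSum_diffVec, if_neg (by omega)]
  refine ⟨φ, fun k hk => ⟨e.symm ⟨k, by omega⟩, (e.symm _).2, fun v => h1 _ v, fun v a => ?_⟩,
    fun v => ?_, fun i hi => ⟨e ⟨i, hi⟩, (e _).2, fun v => ?_, fun v a => ?_⟩, h6, fun y hy => ?_⟩
  · rw [h3]; exact sub_diffFun_smul_diffVec _ _ _
  · rw [h2]
    simp only [prefixSum_apply]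
    exact ⟨fun h k hk => h ⟨k, hk⟩, fun h k => h k k.2⟩
  · have := h1 (e ⟨i, hi⟩) v
    rwa [e.symm_apply_apply] at this
  · have := h3 (e ⟨i, hi⟩) v
    rw [e.symm_apply_apply] at this
    rw [this]; exact sub_diffFun_smul_diffVec _ _ _
  · obtain ⟨v, hv⟩ := h4 y
    have h7 := eq_of_forall_succ_eq (z := φ v - y) (m := n) fun k hk => by
      have := hv ⟨k, hk⟩
      rw [diffFun_apply, diffFun_apply] at this
      simp only [Pi.sub_apply]; linarith
    have h8 : ∑ a ∈ range (n + 1), (φ v - y) a = 0 := by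
      simp only [Pi.sub_apply, sum_sub_distrib, h6, hy, sub_zero]
    rw [sum_congr rfl fun a ha => h7 a (Nat.lt_succ_iff.1 (mem_range.1 ha)), sum_const,
      card_range, nsmul_eq_mul, mul_eq_zero] at h8
    have h9 := h8.resolve_left (by positivity)
    refine ⟨v, fun a ha => ?_⟩
    have := h7 a (by omega)
    rw [h9, Pi.sub_apply] at this
    linarith

/-- Coordinates `φ v a`, for `a < m + 2`, on which the simple reflections act by the transpositions
of neighbouring coordinates and one sign change of the last coordinate, as for the root systems of
types `B` (where `c = 2`) and `C` (where `c = 1`). -/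
structure IsSignedRealization (b : P.Base) (φ : M →ₗ[ℝ] (ℕ → ℝ)) (m : ℕ) (c : ℝ) : Prop where
  chain : b.IsChainRealization φ (m + 2)
  cone : ∀ v, v ∈ b.positiveRootCone ↔ ∀ k < m + 2, 0 ≤ ∑ a ∈ range (k + 1), φ v a
  last : ∃ i ∈ b.support, (∀ v, P.coroot' i v = c * φ v (m + 1)) ∧
    ∀ v a, φ (weylGroup.ofIdx P i • v) a = if a = m + 1 then - φ v a else φ v a
  support : ∀ i ∈ b.support, (∃ k < m + 1, ∀ v, P.coroot' i v = φ v k - φ v (k + 1)) ∨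
    ∀ v, P.coroot' i v = c * φ v (m + 1)
  surj : ∀ y : ℕ → ℝ, ∃ v, ∀ a < m + 2, φ v a = y a

/-- A signed realization for a Cartan matrix `A` that is the matrix of the differences of
neighbouring coordinate vectors and of `d` times the last coordinate vector, with the last coroot
`c` times the last coordinate. -/
lemma isSignedRealization_aux {m : ℕ} {A : Matrix (Fin (m + 2)) (Fin (m + 2)) ℤ}
    (h : b.HasCartanType A) {c d : ℝ} (hcd : c * d = 2) (hd : 0 < d)
    (hA : ∀ l k : Fin (m + 2), (A l k : ℝ) =
      (if (k : ℕ) = m + 1 then c • LinearMap.proj (m + 1) else diffFun k)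
      (if (l : ℕ) = m + 1 then (Pi.single (m + 1) d : ℕ → ℝ) else diffVec l)) :
    ∃ φ : M →ₗ[ℝ] (ℕ → ℝ), IsSignedRealization b φ m c := by
  obtain ⟨e, he⟩ := h
  have hsingle : (Pi.single (m + 1) d : ℕ → ℝ) = d • Pi.single (m + 1) 1 := by
    rw [← Pi.single_smul]; simp
  obtain ⟨φ, h1, h2, h3, h4, -⟩ := b.exists_realization he
    (fun l => if (l : ℕ) = m + 1 then (Pi.single (m + 1) d : ℕ → ℝ) else diffVec l)
    (fun k => if (k : ℕ) = m + 1 then c • LinearMap.proj (m + 1) else diffFun k)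
    (fun k => if (k : ℕ) = m + 1 then d⁻¹ • prefixSum (m + 2) else prefixSum (k + 1))
    (fun l k => (hA l k).symm)
    (fun k l => by
      rw [hsingle]
      simp only [Fin.ext_iff]
      by_cases hk : (k : ℕ) = m + 1 <;> by_cases hl : (l : ℕ) = m + 1
      · rw [if_pos hk, if_pos hl, if_pos (by omega), LinearMap.smul_apply, map_smul,
          prefixSum_single, if_pos (by omega), smul_eq_mul, smul_eq_mul, mul_one,
          inv_mul_cancel₀ hd.ne']
      · rw [if_pos hk, if_neg hl, if_neg (by omega), LinearMap.smul_apply, prefixSum_diffVec,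
          if_neg (by omega), smul_zero]
      · rw [if_neg hk, if_pos hl, if_neg (by omega), map_smul, prefixSum_single,
          if_neg (by omega), smul_zero]
      · rw [if_neg hk, if_neg hl, prefixSum_diffVec])
  have hc : c ≠ 0 := by rintro rfl; simp at hcd
  refine ⟨φ, ⟨fun k hk => ⟨e.symm ⟨k, by omega⟩, (e.symm _).2, fun v => ?_, fun v a => ?_⟩,
    fun v => ?_, ⟨e.symm ⟨m + 1, by omega⟩, (e.symm _).2, fun v => ?_, fun v a => ?_⟩,
    fun i hi => ?_, fun y => ?_⟩⟩
  · rw [h1]; simp only; rw [if_neg (by omega)]; rfl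
  · rw [h3]; simp only
    rw [if_neg (by omega), if_neg (by omega)]
    exact sub_diffFun_smul_diffVec _ _ _
  · rw [h2]
    refine ⟨fun h k hk => ?_, fun h k => ?_⟩
    · have := h ⟨k, hk⟩
      simp only at this
      split_ifs at this with hk'
      · rw [LinearMap.smul_apply, prefixSum_apply, smul_eq_mul] at this
        rw [hk']
        exact nonneg_of_mul_nonneg_right this (inv_pos.2 hd)
      · rwa [prefixSum_apply] at this
    · have := h k k.2
      split_ifs with hk'
      · rw [LinearMap.smul_apply, prefixSum_apply, smul_eq_mul]
        rw [hk'] at this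
        exact mul_nonneg (inv_nonneg.2 hd.le) this
      · rwa [prefixSum_apply]
  · rw [h1]; simp
  · rw [h3]
    simp only [if_true, Pi.sub_apply, Pi.smul_apply, LinearMap.smul_apply, LinearMap.proj_apply,
      smul_eq_mul, Pi.single_apply]
    split_ifs with ha
    · subst ha; linear_combination (- φ v (m + 1)) * hcd
    · simp
  · have := h1 (e ⟨i, hi⟩)
    rw [e.symm_apply_apply] at this
    by_cases hk : (e ⟨i, hi⟩ : ℕ) = m + 1
    · right; intro v; rw [this, if_pos hk]; rfl
    · left; refine ⟨e ⟨i, hi⟩, by omega, fun v => ?_⟩; rw [this, if_neg hk]; rfl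
  · obtain ⟨v, hv⟩ := h4 y
    have h7 := eq_of_forall_succ_eq (z := φ v - y) (m := m + 1) fun k hk => by
      have := hv ⟨k, by omega⟩
      simp only at this
      rw [if_neg (by omega), diffFun_apply, diffFun_apply] at this
      simp only [Pi.sub_apply]; linarith
    have h8 : φ v (m + 1) = y (m + 1) := by
      have := hv ⟨m + 1, by omega⟩
      simpa [hc] using this
    refine ⟨v, fun a ha => ?_⟩
    have := h7 a (by omega)
    simp only [Pi.sub_apply] at this
    linarith

lemma HasCartanType.exists_realization_B {m : ℕ}
    (h : b.HasCartanType (CartanMatrix.B (m + 2))) :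
    ∃ φ : M →ₗ[ℝ] (ℕ → ℝ), IsSignedRealization b φ m 2 :=
  isSignedRealization_aux h (d := 1) (by norm_num) (by norm_num) fun l k => by
    simp only [CartanMatrix.B, Matrix.of_apply, Fin.ext_iff]
    split_ifs <;> simp [diffFun_apply, diffVec, Pi.single_apply] <;> (try split_ifs) <;>
      first | omega | norm_num

lemma HasCartanType.exists_realization_C {m : ℕ}
    (h : b.HasCartanType (CartanMatrix.C (m + 2))) :
    ∃ φ : M →ₗ[ℝ] (ℕ → ℝ), IsSignedRealization b φ m 1 :=
  isSignedRealization_aux h (d := 2) (by norm_num) (by norm_num) fun l k => by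
    simp only [CartanMatrix.C, Matrix.of_apply, Fin.ext_iff]
    split_ifs <;> simp [diffFun_apply, diffVec, Pi.single_apply] <;> (try split_ifs) <;>
      first | omega | norm_num

end Classical

/-! ### Coordinates for type D and negative coroots of classical types -/

section ClassicalLower

open Finset

variable {ι M N : Type*} [Finite ι] [AddCommGroup M] [Module ℝ M] [AddCommGroup N] [Module ℝ N]
  {P : RootPairing ι ℝ M N} [P.IsRootSystem] [P.IsCrystallographic] [P.IsReduced] {b : P.Base}

/-- Coordinates `φ v a`, for `a < m + 2`, on which the simple reflections act by the transpositions
of neighbouring coordinates and by the exchange of the last two coordinates together with their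
signs, as for the root systems of type `D`. -/
structure IsEvenSignedRealization (b : P.Base) (φ : M →ₗ[ℝ] (ℕ → ℝ)) (m : ℕ) : Prop where
  chain : b.IsChainRealization φ (m + 2)
  cone : ∀ v, v ∈ b.positiveRootCone ↔ (∀ k < m, 0 ≤ ∑ a ∈ range (k + 1), φ v a) ∧
    0 ≤ ∑ a ∈ range (m + 1), φ v a - φ v (m + 1) ∧ 0 ≤ ∑ a ∈ range (m + 1), φ v a + φ v (m + 1)
  last : ∃ i ∈ b.support, (∀ v, P.coroot' i v = φ v m + φ v (m + 1)) ∧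
    ∀ v a, φ (weylGroup.ofIdx P i • v) a =
      if a = m then - φ v (m + 1) else if a = m + 1 then - φ v m else φ v a
  support : ∀ i ∈ b.support, (∃ k < m + 1, ∀ v, P.coroot' i v = φ v k - φ v (k + 1)) ∨
    ∀ v, P.coroot' i v = φ v m + φ v (m + 1)
  surj : ∀ y : ℕ → ℝ, ∃ v, ∀ a < m + 2, φ v a = y a

lemma HasCartanType.exists_realization_D {m : ℕ} (hm : 1 ≤ m)
    (h : b.HasCartanType (CartanMatrix.D (m + 2))) :
    ∃ φ : M →ₗ[ℝ] (ℕ → ℝ), IsEvenSignedRealization b φ m := by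
  obtain ⟨e, he⟩ := h
  obtain ⟨φ, h1, h2, h3, h4, -⟩ := b.exists_realization he
    (fun l => if (l : ℕ) = m + 1 then (Pi.single m 1 + Pi.single (m + 1) 1 : ℕ → ℝ)
      else diffVec l)
    (fun k => if (k : ℕ) = m + 1 then
      (LinearMap.proj m : (ℕ → ℝ) →ₗ[ℝ] ℝ) + LinearMap.proj (m + 1) else diffFun k)
    (fun k => if (k : ℕ) = m + 1 then (2⁻¹ : ℝ) • (prefixSum (m + 1) + LinearMap.proj (m + 1))
      else if (k : ℕ) = m then (2⁻¹ : ℝ) • (prefixSum (m + 1) - LinearMap.proj (m + 1))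
      else prefixSum (k + 1))
    (fun l k => by
      simp only [CartanMatrix.D, Matrix.of_apply, Fin.ext_iff]
      split_ifs <;> simp [diffFun_apply, diffVec, Pi.single_apply] <;> (try split_ifs) <;>
        first | omega | norm_num)
    (fun k l => by
      simp only [Fin.ext_iff]
      by_cases hl : (l : ℕ) = m + 1
      · rw [if_pos hl]
        split_ifs with hk hk' hk''
        all_goals try omega
        all_goals simp only [LinearMap.smul_apply, LinearMap.add_apply, LinearMap.sub_apply,
          map_add, prefixSum_single, LinearMap.proj_apply, Pi.single_apply, smul_eq_mul]
        all_goals split_ifs <;> first | omega | norm_num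
      · rw [if_neg hl]
        split_ifs with hk hk' hk'' hk''
        all_goals try omega
        all_goals simp only [LinearMap.smul_apply, LinearMap.add_apply, LinearMap.sub_apply,
          diffVec, map_sub, prefixSum_single, LinearMap.proj_apply, Pi.single_apply,
          smul_eq_mul]
        all_goals split_ifs <;> first | omega | norm_num)
  refine ⟨φ, ⟨fun k hk => ⟨e.symm ⟨k, by omega⟩, (e.symm _).2, fun v => ?_, fun v a => ?_⟩,
    fun v => ?_, ⟨e.symm ⟨m + 1, by omega⟩, (e.symm _).2, fun v => ?_, fun v a => ?_⟩,
    fun i hi => ?_, fun y => ?_⟩⟩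
  · rw [h1]; simp only; rw [if_neg (by omega)]; rfl
  · rw [h3]; simp only
    rw [if_neg (by omega), if_neg (by omega)]
    exact sub_diffFun_smul_diffVec _ _ _
  · rw [h2]
    refine ⟨fun h => ⟨fun k hk => ?_, ?_, ?_⟩, fun ⟨ha, hb, hc⟩ k => ?_⟩
    · have := h ⟨k, by omega⟩
      simp only at this
      rwa [if_neg (by omega), if_neg (by omega), prefixSum_apply] at this
    · have := h ⟨m, by omega⟩
      simp only at this
      rw [if_neg (by omega), if_pos trivial] at this
      simp only [LinearMap.smul_apply, LinearMap.sub_apply, prefixSum_apply, smul_eq_mul,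
        LinearMap.proj_apply] at this
      linarith
    · have := h ⟨m + 1, by omega⟩
      simp only at this
      rw [if_pos trivial] at this
      simp only [LinearMap.smul_apply, LinearMap.add_apply, prefixSum_apply, smul_eq_mul,
        LinearMap.proj_apply] at this
      linarith
    · split_ifs with hk hk'
      · simp only [LinearMap.smul_apply, LinearMap.add_apply, prefixSum_apply, smul_eq_mul,
          LinearMap.proj_apply]
        linarith
      · simp only [LinearMap.smul_apply, LinearMap.sub_apply, prefixSum_apply, smul_eq_mul,
          LinearMap.proj_apply]
        linarith
      · rw [prefixSum_apply]; exact ha k (by omega)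
  · rw [h1]; simp
  · rw [h3]
    simp only [if_true, Pi.sub_apply, Pi.smul_apply, Pi.add_apply, LinearMap.add_apply,
      LinearMap.proj_apply, smul_eq_mul, Pi.single_apply]
    split_ifs <;> subst_vars <;> first | omega | ring
  · have := h1 (e ⟨i, hi⟩)
    rw [e.symm_apply_apply] at this
    by_cases hk : (e ⟨i, hi⟩ : ℕ) = m + 1
    · right; intro v; rw [this, if_pos hk]; rfl
    · left; refine ⟨e ⟨i, hi⟩, by omega, fun v => ?_⟩; rw [this, if_neg hk]; rfl
  · obtain ⟨v, hv⟩ := h4 y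
    have h7 := eq_of_forall_succ_eq (z := φ v - y) (m := m + 1) fun k hk => by
      have := hv ⟨k, by omega⟩
      simp only at this
      rw [if_neg (by omega), diffFun_apply, diffFun_apply] at this
      simp only [Pi.sub_apply]; linarith
    have h8 : φ v m + φ v (m + 1) = y m + y (m + 1) := by
      have := hv ⟨m + 1, by omega⟩
      simpa using this
    have h9 := h7 m (by omega)
    simp only [Pi.sub_apply] at h9
    refine ⟨v, fun a ha => ?_⟩
    have := h7 a (by omega)
    simp only [Pi.sub_apply] at this
    linarith

/-- Functionals `φ v a + s * φ v c` with `a ≤ c < n` and `s = ±1` are distinct, the value of `s`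
being fixed in the case of `a = c`. -/
lemma coordSum_injOn {φ : M →ₗ[ℝ] (ℕ → ℝ)} {n : ℕ} {s₀ : ℝ} (hs₀ : 1 + s₀ ≠ 0)
    (hsurj : ∀ y : ℕ → ℝ, ∃ v, ∀ a < n, φ v a = y a) :
    Set.InjOn (fun p : ℝ × ℕ × ℕ => coordSum φ p.1 p.2.1 p.2.2)
      {p | p.2.2 < n ∧ ((p.2.1 < p.2.2 ∧ p.1 ≠ 0) ∨ (p.2.1 = p.2.2 ∧ p.1 = s₀))} := by
  rintro ⟨s, a, c⟩ ⟨hc, h⟩ ⟨s', a', c'⟩ ⟨hc', h'⟩ heq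
  dsimp only at *
  have key : ∀ d, (if a = d then (1 : ℝ) else 0) + s * (if c = d then 1 else 0) =
      (if a' = d then 1 else 0) + s' * (if c' = d then 1 else 0) := by
    intro d
    obtain ⟨v, hv⟩ := hsurj fun i => if i = d then 1 else 0
    have := LinearMap.congr_fun heq v
    rw [coordSum_apply, coordSum_apply] at this
    rwa [hv a (by omega), hv c hc, hv a' (by omega), hv c' hc'] at this
  have ka := key a
  have kc := key c
  have ka' := key a'
  have kc' := key c'
  have ea : a = a' := by
    rcases lt_trichotomy a a' with hlt | heq | hlt
    · rw [if_pos rfl, if_neg (show ¬ a' = a by omega), if_neg (show ¬ c' = a by omega)] at ka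
      rcases h with h | h
      · rw [if_neg (show ¬ c = a by omega)] at ka; norm_num at ka
      · rw [if_pos h.1.symm, h.2] at ka; norm_num at ka; exact absurd ka hs₀
    · exact heq
    · rw [if_pos rfl, if_neg (show ¬ a = a' by omega), if_neg (show ¬ c = a' by omega)] at ka'
      rcases h' with h | h
      · rw [if_neg (show ¬ c' = a' by omega)] at ka'; norm_num at ka'
      · rw [if_pos h.1.symm, h.2] at ka'; norm_num at ka'; exact absurd ka'.symm hs₀
  subst ea
  have ec : c = c' := by
    rcases lt_trichotomy c c' with hlt | heq | hlt
    · rw [if_pos rfl, if_neg (show ¬ c = c' by omega), if_neg (show ¬ a = c' by omega)] at kc'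
      rcases h' with h | h
      · norm_num at kc'; exact absurd kc'.symm h.2
      · omega
    · exact heq
    · rw [if_pos rfl, if_neg (show ¬ c' = c by omega), if_neg (show ¬ a = c by omega)] at kc
      rcases h with h | h
      · norm_num at kc; exact absurd kc h.2
      · omega
  subst ec
  rw [if_pos rfl] at kc
  simp only [Prod.mk.injEq, and_true]
  linarith

/-- A bound from below for `negCount v` by negative functionals of the form
`φ v a + s * φ v c`. -/
lemma le_negCount_of_injOn {φ : M →ₗ[ℝ] (ℕ → ℝ)} {n : ℕ} {s₀ : ℝ} (hs₀ : 1 + s₀ ≠ 0)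
    (hsurj : ∀ y : ℕ → ℝ, ∃ v, ∀ a < n, φ v a = y a) {v : M} {τ : Type*} (S : Finset τ)
    (T : τ → ℝ × ℕ × ℕ) (hT : Set.InjOn T S)
    (hT' : ∀ t ∈ S, (T t).2.2 < n ∧ (((T t).2.1 < (T t).2.2 ∧ (T t).1 ≠ 0) ∨
      ((T t).2.1 = (T t).2.2 ∧ (T t).1 = s₀)))
    (hpos : ∀ t ∈ S, ∃ i, b.IsPos i ∧ P.coroot' i = coordSum φ (T t).1 (T t).2.1 (T t).2.2)
    (hneg : ∀ t ∈ S, φ v (T t).2.1 + (T t).1 * φ v (T t).2.2 < 0) : S.card ≤ b.negCount v :=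
  b.card_le_negCount S (fun t => coordSum φ (T t).1 (T t).2.1 (T t).2.2)
    (fun _ hs _ ht h => hT hs ht (coordSum_injOn hs₀ hsurj (hT' _ hs) (hT' _ ht) h)) hpos hneg

namespace IsChainRealization

variable {φ : M →ₗ[ℝ] (ℕ → ℝ)} {m : ℕ}

lemma apply_lt_apply (h : b.IsChainRealization φ m) {v : M}
    (hv : ∀ k ∈ b.support, 0 < P.coroot' k v) {a c : ℕ} (hac : a < c) (hc : c < m) :
    φ v c < φ v a := by
  induction c, hac using Nat.le_induction with
  | base =>
    obtain ⟨i, hi, hi', -⟩ := h a hc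
    have := hv i hi
    rw [hi'] at this; linarith
  | succ c hac ih =>
    obtain ⟨i, hi, hi', -⟩ := h c hc
    have := hv i hi
    have := ih (by omega)
    rw [hi'] at *; linarith

/-- Positivity is tested at a strictly dominant vector, whose coordinates decrease. -/
lemma exists_isPos_sub (h : b.IsChainRealization φ m) {a c : ℕ} (hac : a < c) (hc : c < m) :
    ∃ i, b.IsPos i ∧ P.coroot' i = coordSum φ (-1) a c := by
  obtain ⟨i, hi⟩ := h.exists_coroot'_eq_sub hac hc
  obtain ⟨v, hv⟩ := b.exists_coroot'_eq fun _ => 1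
  have hv' : ∀ k ∈ b.support, 0 < P.coroot' k v := fun k hk => by
    rw [hv ⟨k, hk⟩]; exact one_pos
  refine ⟨i, ?_, hi⟩
  rw [b.isPos_iff_coroot'_pos hv', hi, coordSum_apply]
  linarith [h.apply_lt_apply hv' hac hc]

lemma exists_isPos_add (h : b.IsChainRealization φ (m + 2))
    (hlast : ∃ i, P.coroot' i = coordSum φ 1 m (m + 1))
    (hpos : ∀ v : M, (∀ k ∈ b.support, 0 < P.coroot' k v) → 0 < φ v m + φ v (m + 1))
    {a c : ℕ} (hac : a < c) (hc : c < m + 2) :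
    ∃ i, b.IsPos i ∧ P.coroot' i = coordSum φ 1 a c := by
  obtain ⟨i, hi⟩ := h.exists_coroot'_eq_add hlast hac hc
  obtain ⟨v, hv⟩ := b.exists_coroot'_eq fun _ => 1
  have hv' : ∀ k ∈ b.support, 0 < P.coroot' k v := fun k hk => by
    rw [hv ⟨k, hk⟩]; exact one_pos
  refine ⟨i, ?_, hi⟩
  rw [b.isPos_iff_coroot'_pos hv', hi, coordSum_apply]
  have h1 := hpos v hv'
  have h2 : φ v m ≤ φ v a := by
    rcases (show a ≤ m by omega).eq_or_lt with rfl | h2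
    · exact le_rfl
    · exact (h.apply_lt_apply hv' h2 (by omega)).le
  have h3 : φ v (m + 1) ≤ φ v c := by
    rcases (show c ≤ m + 1 by omega).eq_or_lt with rfl | h3
    · exact le_rfl
    · exact (h.apply_lt_apply hv' h3 (by omega)).le
  linarith

/-- Multiples of a coordinate are coroots if those of the last coordinate are. -/
lemma exists_coroot'_eq_single (h : b.IsChainRealization φ (m + 2)) {s : ℝ}
    (hlast : ∃ i, P.coroot' i = coordSum φ s (m + 1) (m + 1)) {a : ℕ} (ha : a ≤ m + 1) :
    ∃ i, P.coroot' i = coordSum φ s a a := by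
  induction ha using Nat.decreasingInduction with
  | self => exact hlast
  | of_succ a ha ih =>
    obtain ⟨i, -, -, hi⟩ := h a (by omega)
    refine exists_coroot'_comp ih i fun v => ?_
    rw [coordSum_apply, coordSum_apply, hi, Equiv.swap_apply_right]

end IsChainRealization

namespace IsSignedRealization

variable {φ : M →ₗ[ℝ] (ℕ → ℝ)} {m : ℕ} {c : ℝ}

lemma last_pos (h : IsSignedRealization b φ m c) (hc : 0 < c) {v : M}
    (hv : ∀ k ∈ b.support, 0 < P.coroot' k v) {a : ℕ} (ha : a ≤ m + 1) : 0 < φ v a := by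
  obtain ⟨i, hi, hi', -⟩ := h.last
  have h1 := hv i hi
  rw [hi'] at h1
  have h2 := pos_of_mul_pos_right h1 hc.le
  rcases ha.eq_or_lt with rfl | h3
  · exact h2
  · exact h2.trans (h.chain.apply_lt_apply hv h3 (by omega))

lemma exists_isPos_add (h : IsSignedRealization b φ m c) (hc : 0 < c) {a d : ℕ} (had : a < d)
    (hd : d < m + 2) : ∃ i, b.IsPos i ∧ P.coroot' i = coordSum φ 1 a d := by
  refine h.chain.exists_isPos_add ?_ (fun v hv => add_pos (h.last_pos hc hv (by omega))
    (h.last_pos hc hv le_rfl)) had hd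
  obtain ⟨i, -, -, hi⟩ := h.last
  refine exists_coroot'_comp (h.chain.exists_coroot'_eq_sub (a := m) (c := m + 1) (by omega)
    (by omega)) i fun v => ?_
  rw [coordSum_apply, coordSum_apply, hi, hi, if_neg (by omega), if_pos rfl]
  ring

lemma exists_isPos_single (h : IsSignedRealization b φ m c) (hc : 0 < c) {a : ℕ}
    (ha : a < m + 2) : ∃ i, b.IsPos i ∧ P.coroot' i = coordSum φ (c - 1) a a := by
  have hlast : ∃ i, P.coroot' i = coordSum φ (c - 1) (m + 1) (m + 1) := by
    obtain ⟨i, -, hi, -⟩ := h.last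
    refine ⟨i, ?_⟩
    ext v
    rw [hi, coordSum_apply]; ring
  obtain ⟨i, hi⟩ := h.chain.exists_coroot'_eq_single hlast (a := a) (by omega)
  obtain ⟨v, hv⟩ := b.exists_coroot'_eq fun _ => 1
  have hv' : ∀ k ∈ b.support, 0 < P.coroot' k v := fun k hk => by
    rw [hv ⟨k, hk⟩]; exact one_pos
  refine ⟨i, ?_, hi⟩
  rw [b.isPos_iff_coroot'_pos hv', hi, coordSum_apply]
  have := mul_pos hc (h.last_pos hc hv' (a := a) (by omega))
  linarith

/-- If the sum of the first `j` coordinates is negative, then for every residue `t` modulo `j` some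
functional `φ v a + φ v d` with `a + d ≡ t` is negative, where a multiple of `φ v a` takes the place
of `φ v a + φ v a`; and for every `t ≥ j` one of two functionals `φ v a ± φ v t` is negative. These
functionals are distinct since `t` can be read off from them. -/
lemma le_negCount (h : IsSignedRealization b φ m c) (hc : 0 < c) {v : M}
    (hv : v ∉ b.positiveRootCone) : m + 2 ≤ b.negCount v := by
  rw [h.cone] at hv
  push Not at hv
  obtain ⟨k, hk, hsum⟩ := hv
  have hex : ∀ t ∈ range (m + 2), ∃ p : ℝ × ℕ × ℕ,
      (p.2.2 < m + 2 ∧ ((p.2.1 < p.2.2 ∧ p.1 ≠ 0) ∨ (p.2.1 = p.2.2 ∧ p.1 = c - 1))) ∧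
      (∃ i, b.IsPos i ∧ P.coroot' i = coordSum φ p.1 p.2.1 p.2.2) ∧
      φ v p.2.1 + p.1 * φ v p.2.2 < 0 ∧
      (if p.2.2 < k + 1 then (p.2.1 + p.2.2) % (k + 1) else p.2.2) = t := by
    intro t ht
    rw [mem_range] at ht
    rcases lt_or_ge t (k + 1) with htk | htk
    · obtain ⟨a, d, had, hd, hmod, hlt⟩ := exists_residue_pair htk hsum
      have hdm : d < m + 2 := by omega
      have ham : a < m + 2 := by omega
      rcases had.eq_or_lt with rfl | had
      · refine ⟨(c - 1, a, a), ⟨ham, Or.inr ⟨rfl, rfl⟩⟩,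
          h.exists_isPos_single hc (by omega), ?_, ?_⟩
        · have : φ v a < 0 := by linarith
          have := mul_neg_of_pos_of_neg hc this
          dsimp only; linarith
        · dsimp only; rw [if_pos hd, hmod]
      · refine ⟨(1, a, d), ⟨hdm, Or.inl ⟨had, one_ne_zero⟩⟩,
          h.exists_isPos_add hc had (by omega), by simpa using hlt, ?_⟩
        dsimp only; rw [if_pos hd, hmod]
    · obtain ⟨a, ha, haneg⟩ : ∃ a ∈ range (k + 1), φ v a < 0 := by
        by_contra! hge
        exact absurd hsum (not_lt.2 (sum_nonneg hge))
      rw [mem_range] at ha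
      have hat : a < t := by omega
      rcases lt_or_ge (φ v t) 0 with h1 | h1
      · refine ⟨(1, a, t), ⟨ht, Or.inl ⟨hat, one_ne_zero⟩⟩,
          h.exists_isPos_add hc (by omega) ht, by dsimp only; linarith, ?_⟩
        dsimp only; rw [if_neg (by omega)]
      · refine ⟨(-1, a, t), ⟨ht, Or.inl ⟨hat, by norm_num⟩⟩,
          h.chain.exists_isPos_sub (by omega) ht, by dsimp only; linarith, ?_⟩
        dsimp only; rw [if_neg (by omega)]
  choose! T h1 h2 h3 h4 using hex
  have := le_negCount_of_injOn (s₀ := c - 1) (by linarith [hc.ne'] : 1 + (c - 1) ≠ 0) h.surj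
    (range (m + 2)) T (fun s hs t ht hst => by rw [← h4 s hs, ← h4 t ht, hst]) h1 h2 h3
  rwa [card_range] at this

end IsSignedRealization

namespace IsEvenSignedRealization

variable {φ : M →ₗ[ℝ] (ℕ → ℝ)} {m : ℕ}

lemma exists_isPos_add (h : IsEvenSignedRealization b φ m) {a d : ℕ} (had : a < d)
    (hd : d < m + 2) : ∃ i, b.IsPos i ∧ P.coroot' i = coordSum φ 1 a d := by
  obtain ⟨i, hi, hi', -⟩ := h.last
  refine h.chain.exists_isPos_add ⟨i, ?_⟩ (fun v hv => ?_) had hd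
  · ext v; rw [hi', coordSum_apply, one_mul]
  · rw [← hi']; exact hv i hi

/-- If the sum of the first `k + 1` coordinates is negative and these are not all, then for every
residue `t` modulo `k + 1` there is a negative functional `φ v a + φ v d` with `a + d ≡ t`, or else
one of `φ v a ± φ v (k + 1)` with `2 * a ≡ t` is negative; for every `t > k + 1` one of two
functionals `φ v a ± φ v t` is negative. -/
lemma le_negCount_of_prefix (h : IsEvenSignedRealization b φ m) {v : M} {k : ℕ}
    (hk : k + 1 < m + 2) (hsum : ∑ a ∈ range (k + 1), φ v a < 0) : m + 1 ≤ b.negCount v := by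
  have hpm : ∀ a t, a < t → t < m + 2 → φ v a < 0 → ∃ s : ℝ, s ≠ 0 ∧
      (∃ i, b.IsPos i ∧ P.coroot' i = coordSum φ s a t) ∧ φ v a + s * φ v t < 0 := by
    intro a t hat ht ha
    rcases lt_or_ge (φ v t) 0 with h1 | h1
    · exact ⟨1, one_ne_zero, h.exists_isPos_add hat ht, by linarith⟩
    · exact ⟨-1, by norm_num, h.chain.exists_isPos_sub hat ht, by linarith⟩
  have hex : ∀ t ∈ (range (m + 2)).erase (k + 1), ∃ p : ℝ × ℕ × ℕ,
      (p.2.2 < m + 2 ∧ ((p.2.1 < p.2.2 ∧ p.1 ≠ 0) ∨ (p.2.1 = p.2.2 ∧ p.1 = 0))) ∧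
      (∃ i, b.IsPos i ∧ P.coroot' i = coordSum φ p.1 p.2.1 p.2.2) ∧
      φ v p.2.1 + p.1 * φ v p.2.2 < 0 ∧
      (if p.2.2 < k + 1 then (p.2.1 + p.2.2) % (k + 1)
        else if p.2.2 = k + 1 then (p.2.1 + p.2.1) % (k + 1) else p.2.2) = t := by
    intro t ht
    rw [mem_erase, mem_range] at ht
    obtain ⟨htk', ht⟩ := ht
    rcases lt_or_ge t (k + 1) with htk | htk
    · obtain ⟨a, d, had, hd, hmod, hlt⟩ := exists_residue_pair htk hsum
      have hdm : d < m + 2 := by omega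
      rcases had.eq_or_lt with rfl | had
      · obtain ⟨s, hs, hpos, hneg⟩ := hpm a (k + 1) hd hk (by linarith)
        refine ⟨(s, a, k + 1), ⟨hk, Or.inl ⟨hd, hs⟩⟩, hpos, hneg, ?_⟩
        dsimp only; rw [if_neg (by omega), if_pos rfl, hmod]
      · refine ⟨(1, a, d), ⟨hdm, Or.inl ⟨had, one_ne_zero⟩⟩,
          h.exists_isPos_add had (by omega), by simpa using hlt, ?_⟩
        dsimp only; rw [if_pos hd, hmod]
    · obtain ⟨a, ha, haneg⟩ : ∃ a ∈ range (k + 1), φ v a < 0 := by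
        by_contra! hge
        exact absurd hsum (not_lt.2 (sum_nonneg hge))
      rw [mem_range] at ha
      have hat : a < t := by omega
      obtain ⟨s, hs, hpos, hneg⟩ := hpm a t (by omega) ht haneg
      refine ⟨(s, a, t), ⟨ht, Or.inl ⟨hat, hs⟩⟩, hpos, hneg, ?_⟩
      dsimp only; rw [if_neg (by omega), if_neg (by omega)]
  choose! T h1 h2 h3 h4 using hex
  have := le_negCount_of_injOn (s₀ := 0) (by norm_num) h.surj
    ((range (m + 2)).erase (k + 1)) T (fun s hs t ht hst => by rw [← h4 s hs, ← h4 t ht, hst])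
    h1 h2 h3
  rwa [card_erase_of_mem (mem_range.2 hk), card_range] at this

/-- If a signed sum of all coordinates, with at most the last sign negative, is negative, then so
are many of the signed sums of two coordinates. -/
lemma le_negCount_of_total (h : IsEvenSignedRealization b φ m) (hm : 2 ≤ m) (hm' : m ≠ 3) {v : M}
    {s : ℝ} (hs : s = 1 ∨ s = -1)
    (hsum : ∑ a ∈ range (m + 1), φ v a + s * φ v (m + 1) < 0) : m + 1 ≤ b.negCount v := by
  set x : ℕ → ℝ := fun a => if a = m + 1 then s * φ v a else φ v a with hx
  have hsum' : ∑ a ∈ range (m + 2), x a < 0 := by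
    rw [sum_range_succ, hx]
    simp only [if_true]
    convert hsum using 2
    refine sum_congr rfl fun a ha => if_neg ?_
    rw [mem_range] at ha; omega
  have hcard := card_neg_pairs_ge' x _ hsum'
  rw [card_range, if_neg (by omega), if_neg (by omega)] at hcard
  refine le_trans hcard (le_negCount_of_injOn (s₀ := 0) (by norm_num) h.surj _
    (fun p => (if p.2 = m + 1 then s else 1, p.1, p.2))
    (fun p _ q _ hpq => by simp only [Prod.mk.injEq] at hpq; exact Prod.ext hpq.2.1 hpq.2.2)
    (fun p hp => ?_) (fun p hp => ?_) fun p hp => ?_) <;>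
  · simp only [mem_filter, mem_product, mem_range] at hp ⊢
    obtain ⟨⟨hp1, hp2⟩, hlt, hneg⟩ := hp
    first
    | refine ⟨hp2, Or.inl ⟨hlt, ?_⟩⟩
      rcases hs with rfl | rfl <;> split_ifs <;> norm_num
    | rcases hs with rfl | rfl
      · rw [ite_self]; exact h.exists_isPos_add hlt hp2
      · split_ifs
        · exact h.chain.exists_isPos_sub hlt hp2
        · exact h.exists_isPos_add hlt hp2
    | rw [hx] at hneg
      simp only at hneg
      rw [if_neg (by omega)] at hneg
      split_ifs at hneg ⊢ <;> linarith

lemma le_negCount (h : IsEvenSignedRealization b φ m) (hm : 2 ≤ m) (hm' : m ≠ 3) {v : M}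
    (hv : v ∉ b.positiveRootCone) : m + 1 ≤ b.negCount v := by
  rw [h.cone] at hv
  by_cases h1 : ∃ k < m, ∑ a ∈ range (k + 1), φ v a < 0
  · obtain ⟨k, hk, h1⟩ := h1
    exact h.le_negCount_of_prefix (by omega) h1
  push Not at h1
  by_cases h2 : 0 ≤ ∑ a ∈ range (m + 1), φ v a - φ v (m + 1)
  · have h3 : ¬ 0 ≤ ∑ a ∈ range (m + 1), φ v a + φ v (m + 1) := fun h3 => hv ⟨h1, h2, h3⟩
    exact h.le_negCount_of_total hm hm' (Or.inl rfl) (by linarith)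
  · exact h.le_negCount_of_total hm hm' (Or.inr rfl) (by linarith)

end IsEvenSignedRealization

end ClassicalLower

/-! ### The invariants of the classical types -/

section ClassicalValues

open Finset

variable {ι M N : Type*} [Finite ι] [AddCommGroup M] [Module ℝ M] [AddCommGroup N] [Module ℝ N]
  {P : RootPairing ι ℝ M N} [P.IsRootSystem] [P.IsCrystallographic] [P.IsReduced] {b : P.Base}

lemma smul_smul_eq_neg_of_smul_eq_neg {v : M} {u : P.weylGroup} (hu : u • v = -v)
    (w : P.weylGroup) : (w * u * w⁻¹) • w • v = -(w • v) := by
  rw [mul_smul, mul_smul, inv_smul_smul, hu, smul_neg]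

/-- The first coordinate of a multiple of the first fundamental weight is made negative by a single
reflection. -/
lemma HasCartanType.ellInvariant_A {n : ℕ} (hn : 1 ≤ n)
    (h : b.HasCartanType (CartanMatrix.A n)) : b.ellInvariant = 1 := by
  obtain ⟨φ, hchain, hcone, hsupp, hsum, hex⟩ := h.exists_realization_A
  obtain ⟨v, hv⟩ := hex (fun a => if a = 0 then n else -1) (by
    rw [sum_range_succ']; simp)
  have hdom : v ∈ b.dominantWeights := by
    rw [mem_dominantWeights_iff]
    refine ⟨fun i hi => ?_, fun i hi => ?_⟩ <;> obtain ⟨k, hk, hik, -⟩ := hsupp i hi <;>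
      rw [hik, hv k (by omega), hv (k + 1) (by omega), if_neg (Nat.succ_ne_zero k)] <;> split_ifs
    · exact ⟨n + 1, by push_cast; ring⟩
    · exact ⟨0, by simp⟩
    · have : (0 : ℝ) ≤ n := n.cast_nonneg
      linarith
    · simp
  obtain ⟨w, hw, hw'⟩ := hchain.exists_word_apply_zero (q := 1) (by omega)
  have hbad : w • v ∉ b.positiveRootCone := by
    rw [hcone]
    intro h
    have := h 0 (by omega)
    rw [zero_add, sum_range_one, hw', hv 1 (by omega)] at this
    norm_num at this
  refine le_antisymm ((b.ellInvariant_le hdom hbad).trans hw)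
    (b.le_ellInvariant hdom hbad fun w v _ hwv => ?_)
  rw [hcone] at hwv
  push Not at hwv
  obtain ⟨k, hk, hneg⟩ := hwv
  have hpos : 0 < ∑ a ∈ Ico (k + 1) (n + 1), φ (w • v) a := by
    have := sum_range_add_sum_Ico (fun a => φ (w • v) a) (show k + 1 ≤ n + 1 by omega)
    rw [hsum] at this
    linarith
  obtain ⟨a, ha, haneg⟩ := exists_lt_of_sum_lt (f := fun a => φ (w • v) a) (g := fun _ => (0 : ℝ))
    (s := range (k + 1)) (by rwa [sum_const_zero])
  obtain ⟨c, hc, hcpos⟩ := exists_lt_of_sum_lt (g := fun a => φ (w • v) a) (f := fun _ => (0 : ℝ))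
    (s := Ico (k + 1) (n + 1)) (by rwa [sum_const_zero])
  rw [mem_range] at ha
  rw [mem_Ico] at hc
  have := b.card_le_negCount {()} (fun _ => coordSum φ (-1) a c) (by simp)
    (fun _ _ => hchain.exists_isPos_sub (by omega) hc.2) (v := w • v) (fun _ _ => by
      rw [coordSum_apply]; linarith)
  simpa using this

/-- In type `A` every Weyl group element permutes the coordinates. -/
lemma exists_perm_of_forall_swap {φ : M →ₗ[ℝ] (ℕ → ℝ)} {n : ℕ}
    (h : ∀ i ∈ b.support, ∃ k < n, ∀ v a,
      φ (weylGroup.ofIdx P i • v) a = φ v (Equiv.swap k (k + 1) a)) (w : P.weylGroup) :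
    ∃ σ : Equiv.Perm ℕ, (∀ a, a < n + 1 → σ a < n + 1) ∧ (∀ a, a < n + 1 → σ.symm a < n + 1) ∧
      ∀ v a, φ (w • v) a = φ v (σ a) := by
  obtain ⟨L, hL, rfl⟩ := b.exists_simple_word w
  induction L with
  | nil => exact ⟨1, fun _ h => h, fun _ h => h, by simp⟩
  | cons i L ih =>
    obtain ⟨σ, h1, h2, h3⟩ := ih fun j hj => hL j (by simp [hj])
    obtain ⟨k, hk, hk'⟩ := h i (hL i (by simp))
    have hswap : ∀ a, a < n + 1 → Equiv.swap k (k + 1) a < n + 1 := fun a ha => by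
      rw [Equiv.swap_apply_def]; split_ifs <;> omega
    refine ⟨σ * Equiv.swap k (k + 1), fun a ha => h1 _ (hswap a ha), fun a ha => ?_,
      fun v a => ?_⟩
    · exact hswap _ (h2 a ha)
    · rw [List.map_cons, List.prod_cons, mul_smul, hk', h3, Equiv.Perm.mul_apply]

/-- The coordinates of a self-dual weight are symmetric about `0`, so the lower bound is given by
`le_card_lt_pairs_of_symm`. -/
lemma HasCartanType.ellSdInvariant_A {n : ℕ} (hn : 1 ≤ n)
    (h : b.HasCartanType (CartanMatrix.A n)) : b.ellSdInvariant = (n + 2) / 2 := by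
  obtain ⟨φ, hchain, hcone, hsupp, hsum, hex⟩ := h.exists_realization_A
  have hk : (n + 1) / 2 ≤ (n + 2) / 2 := by omega
  -- the self-dual weight with coordinates `1, …, 1, (0), -1, …, -1`
  set y : ℕ → ℤ := fun a => if a < (n + 1) / 2 then 1 else if a < (n + 2) / 2 then 0 else -1 with hy
  have hyrev : ∀ a ≤ n, y (n - a) = - y a := by
    intro a ha
    simp only [hy]
    split_ifs <;> omega
  have hymono : ∀ a, y (a + 1) ≤ y a := by
    intro a
    simp only [hy]
    split_ifs <;> omega
  obtain ⟨v, hv⟩ := hex (fun a => y a) (by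
    have h1 := sum_range_reflect (fun a => (y a : ℝ)) (n + 1)
    have h2 : ∑ a ∈ range (n + 1), (y (n + 1 - 1 - a) : ℝ) = ∑ a ∈ range (n + 1), -(y a : ℝ) :=
      sum_congr rfl fun a ha => by
        rw [mem_range] at ha
        rw [Nat.add_sub_cancel, hyrev a (by omega)]; push_cast; rfl
    rw [h2, sum_neg_distrib] at h1
    linarith)
  have hsd : v ∈ b.selfDualDominantWeights := by
    rw [mem_selfDualDominantWeights_iff, mem_dominantWeights_iff]
    refine ⟨⟨fun i hi => ?_, fun i hi => ?_⟩, ?_⟩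
    · obtain ⟨k, hk, hik, -⟩ := hsupp i hi
      rw [hik, hv k (by omega), hv (k + 1) (by omega)]
      exact ⟨y k - y (k + 1), by push_cast; rfl⟩
    · obtain ⟨k, hk, hik, -⟩ := hsupp i hi
      rw [hik, hv k (by omega), hv (k + 1) (by omega), sub_nonneg]
      exact_mod_cast hymono k
    · obtain ⟨w, hw⟩ := hchain.exists_perm Fin.revPerm
      have hw' : ∀ a < n + 1, φ (w • v) a = - φ v a := by
        intro a ha
        have := hw v ⟨a, ha⟩
        simp only [Fin.revPerm_apply, Fin.val_rev] at this
        rw [this, hv a ha, hv _ (by omega), show n + 1 - (a + 1) = n - a by omega,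
          hyrev a (by omega)]
        push_cast; rfl
      refine ⟨w, b.ext_coroot' fun i hi => ?_⟩
      obtain ⟨k, hk, hik, -⟩ := hsupp i hi
      rw [map_neg, hik, hik, hw' k (by omega), hw' (k + 1) (by omega)]
      ring
  obtain ⟨w, hw, hw'⟩ := hchain.exists_word_apply_zero (q := (n + 2) / 2) (by omega)
  have hbad : w • v ∉ b.positiveRootCone := by
    rw [hcone]
    intro h
    have := h 0 (by omega)
    rw [zero_add, sum_range_one, hw', hv _ (by omega)] at this
    simp only [hy] at this
    rw [if_neg (by omega), if_neg (by omega)] at this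
    norm_num at this
  refine le_antisymm ((b.ellSdInvariant_le hsd hbad).trans hw)
    (b.le_ellSdInvariant hsd hbad fun w v hv hwv => ?_)
  rw [mem_selfDualDominantWeights_iff] at hv
  obtain ⟨-, u, hu⟩ := hv
  obtain ⟨σ, hσ1, hσ2, hσ⟩ := exists_perm_of_forall_swap (φ := φ) (n := n)
    (fun i hi => by obtain ⟨k, hk, -, h⟩ := hsupp i hi; exact ⟨k, hk, h⟩) (w * u * w⁻¹)
  have hσ' : ∀ a, φ (w • v) (σ a) = - φ (w • v) a := fun a => by
    rw [← hσ, smul_smul_eq_neg_of_smul_eq_neg hu, map_neg]; rfl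
  rw [hcone] at hwv
  push Not at hwv
  obtain ⟨k, hk, hneg⟩ := hwv
  have hcount := le_card_lt_pairs_of_symm (x := φ (w • v)) (m := n + 1) (j := k + 1) (by omega)
    (fun t => by
      refine card_nbij' σ σ.symm (fun a ha => ?_) (fun a ha => ?_) (fun a _ => by simp)
        (fun a _ => by simp)
      · simp only [coe_filter, mem_range, Set.mem_ofPred_eq] at ha ⊢
        exact ⟨hσ1 a ha.1, by rw [hσ']; linarith⟩
      · simp only [coe_filter, mem_range, Set.mem_ofPred_eq] at ha ⊢
        have := hσ' (σ.symm a)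
        rw [Equiv.apply_symm_apply] at this
        exact ⟨hσ2 a ha.1, by linarith⟩) hneg
  refine le_trans hcount (b.card_le_negCount _ (fun p => coordSum φ (-1) p.1 p.2) ?_
    (fun p hp => ?_) fun p hp => ?_)
  · rintro ⟨a, c⟩ hp ⟨a', c'⟩ hq heq
    simp only [coe_filter, mem_product, mem_range, mem_Ico, Set.mem_ofPred_eq] at hp hq heq
    obtain ⟨z, hz⟩ := hex (fun d => (if d = a then 1 else 0) - if d = c then 1 else 0) (by
      rw [sum_sub_distrib, sum_ite_eq', sum_ite_eq', if_pos (mem_range.2 (by omega)),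
        if_pos (mem_range.2 (by omega)), sub_self])
    have := LinearMap.congr_fun heq z
    rw [coordSum_apply, coordSum_apply, hz a (by omega), hz c (by omega), hz a' (by omega),
      hz c' (by omega), if_pos rfl, if_pos rfl, if_neg (show ¬ a = c by omega),
      if_neg (show ¬ c = a by omega)] at this
    have h1 : a' = a := by
      by_contra h1
      rw [if_neg h1] at this
      split_ifs at this <;> norm_num at this
    have h2 : c' = c := by
      by_contra h2
      rw [if_neg h2] at this
      split_ifs at this <;> norm_num at this
    rw [h1, h2]
  · simp only [mem_filter, mem_product, mem_range, mem_Ico] at hp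
    exact hchain.exists_isPos_sub (by omega) hp.1.2.2
  · rw [coordSum_apply]
    have := (mem_filter.1 hp).2
    linarith

/-- The common value of both invariants in types `B` and `C`. The first fundamental weight is
moved to the negative of the last coordinate vector. -/
lemma IsSignedRealization.ell_eq {φ : M →ₗ[ℝ] (ℕ → ℝ)} {m : ℕ} {c : ℝ}
    (h : IsSignedRealization b φ m c) (hc : 0 < c) :
    b.ellInvariant = m + 2 ∧ b.ellSdInvariant = m + 2 := by
  obtain ⟨v, hv⟩ := h.surj fun a => if a = 0 then 1 else 0
  obtain ⟨w, hw, hw'⟩ := h.chain.exists_word_single hv (j := m + 1) (by omega)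
  obtain ⟨i, hi, hi', his⟩ := h.last
  have hneg : weylGroup.ofIdx P i • w • v = -(w • v) := by
    refine b.ext_coroot' fun j hj => ?_
    have key : ∀ a < m + 2, φ (weylGroup.ofIdx P i • w • v) a = - φ (w • v) a := by
      intro a ha
      rw [his, hw' a ha]
      split_ifs <;> simp
    rw [map_neg]
    rcases h.support j hj with ⟨k, hk, hjk⟩ | hj
    · rw [hjk, hjk, key k (by omega), key (k + 1) (by omega)]; ring
    · rw [hj, hj, key (m + 1) (by omega)]; ring
  have hsd : v ∈ b.selfDualDominantWeights := by
    rw [mem_selfDualDominantWeights_iff, mem_dominantWeights_iff]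
    refine ⟨⟨fun j hj => ?_, fun j hj => ?_⟩, w⁻¹ * weylGroup.ofIdx P i * w, ?_⟩
    · rcases h.support j hj with ⟨k, hk, hjk⟩ | hj
      · rw [hjk, hv k (by omega), hv (k + 1) (by omega), if_neg (Nat.succ_ne_zero k)]
        split_ifs
        exacts [⟨1, by simp⟩, ⟨0, by simp⟩]
      · rw [hj, hv _ (by omega), if_neg (Nat.succ_ne_zero m)]
        exact ⟨0, by simp⟩
    · rcases h.support j hj with ⟨k, hk, hjk⟩ | hj
      · rw [hjk, hv k (by omega), hv (k + 1) (by omega), if_neg (Nat.succ_ne_zero k)]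
        split_ifs <;> simp
      · rw [hj, hv _ (by omega), if_neg (Nat.succ_ne_zero m)]
        simp
    · rw [mul_smul, mul_smul, hneg, smul_neg, inv_smul_smul]
  have hlen : b.weylLength (weylGroup.ofIdx P i * w) ≤ m + 2 :=
    (b.weylLength_ofIdx_mul_le hi w).trans (by omega)
  have hbad : (weylGroup.ofIdx P i * w) • v ∉ b.positiveRootCone := by
    rw [h.cone]
    intro h'
    have := h' (m + 1) (by omega)
    rw [mul_smul, hneg, map_neg] at this
    simp only [Pi.neg_apply, sum_neg_distrib] at this
    rw [sum_congr rfl fun a ha => hw' a (mem_range.1 ha), sum_ite_eq',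
      if_pos (mem_range.2 (by omega))] at this
    norm_num at this
  exact ⟨le_antisymm ((b.ellInvariant_le hsd.1 hbad).trans hlen)
    (b.le_ellInvariant hsd.1 hbad fun _ _ _ h' => h.le_negCount hc h'),
    le_antisymm ((b.ellSdInvariant_le hsd hbad).trans hlen)
    (b.le_ellSdInvariant hsd hbad fun _ _ _ h' => h.le_negCount hc h')⟩

/-- The common value of both invariants in type `D` for ranks other than `5`. The first fundamental
weight is moved to the last coordinate vector. -/
lemma IsEvenSignedRealization.ell_eq {φ : M →ₗ[ℝ] (ℕ → ℝ)} {m : ℕ}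
    (h : IsEvenSignedRealization b φ m) (hm : 2 ≤ m) (hm' : m ≠ 3) :
    b.ellInvariant = m + 1 ∧ b.ellSdInvariant = m + 1 := by
  obtain ⟨v, hv⟩ := h.surj fun a => if a = 0 then 1 else 0
  obtain ⟨w, hw, hw'⟩ := h.chain.exists_word_single hv (j := m + 1) (by omega)
  obtain ⟨u, -, hu'⟩ := h.chain.exists_word_single hv (j := m) (by omega)
  obtain ⟨i, hi, hi', his⟩ := h.last
  have hneg : weylGroup.ofIdx P i • w • v = -(u • v) := by
    refine b.ext_coroot' fun j hj => ?_
    have key : ∀ a < m + 2, φ (weylGroup.ofIdx P i • w • v) a = - φ (u • v) a := by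
      intro a ha
      rw [his, hw' m (by omega), hw' (m + 1) (by omega), hw' a ha, hu' a ha]
      split_ifs <;> first | omega | simp
    rw [map_neg]
    rcases h.support j hj with ⟨k, hk, hjk⟩ | hj
    · rw [hjk, hjk, key k (by omega), key (k + 1) (by omega)]; ring
    · rw [hj, hj, key m (by omega), key (m + 1) (by omega)]; ring
  have hsd : v ∈ b.selfDualDominantWeights := by
    rw [mem_selfDualDominantWeights_iff, mem_dominantWeights_iff]
    refine ⟨⟨fun j hj => ?_, fun j hj => ?_⟩, u⁻¹ * weylGroup.ofIdx P i * w, ?_⟩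
    · rcases h.support j hj with ⟨k, hk, hjk⟩ | hj
      · rw [hjk, hv k (by omega), hv (k + 1) (by omega), if_neg (Nat.succ_ne_zero k)]
        split_ifs
        exacts [⟨1, by simp⟩, ⟨0, by simp⟩]
      · rw [hj, hv m (by omega), hv _ (by omega), if_neg (by omega), if_neg (Nat.succ_ne_zero m)]
        exact ⟨0, by simp⟩
    · rcases h.support j hj with ⟨k, hk, hjk⟩ | hj
      · rw [hjk, hv k (by omega), hv (k + 1) (by omega), if_neg (Nat.succ_ne_zero k)]
        split_ifs <;> simp
      · rw [hj, hv m (by omega), hv _ (by omega), if_neg (by omega), if_neg (Nat.succ_ne_zero m)]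
        simp
    · rw [mul_smul, mul_smul, hneg, smul_neg, inv_smul_smul]
  have hbad : w • v ∉ b.positiveRootCone := by
    rw [h.cone]
    rintro ⟨-, this, -⟩
    rw [sum_congr rfl fun a ha => hw' a (by have := mem_range.1 ha; omega), sum_ite_eq',
      if_neg (by rw [mem_range]; omega), hw' _ (by omega), if_pos rfl] at this
    norm_num at this
  exact ⟨le_antisymm ((b.ellInvariant_le hsd.1 hbad).trans hw)
    (b.le_ellInvariant hsd.1 hbad fun _ _ _ h' => h.le_negCount hm hm' h'),
    le_antisymm ((b.ellSdInvariant_le hsd hbad).trans hw)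
    (b.le_ellSdInvariant hsd hbad fun _ _ _ h' => h.le_negCount hm hm' h')⟩

end ClassicalValues

/-! ### Searching Weyl group orbits -/

section Computation

variable {n : ℕ}

/-- The value of the `k`-th simple coroot at the vector with simple root coordinates `c`, for the
Cartan matrix `A`. -/
def simplePairing (A : Matrix (Fin n) (Fin n) ℤ) (c : Fin n → ℤ) (k : Fin n) : ℤ :=
  ((List.finRange n).map fun l => c l * A l k).sum

lemma simplePairing_eq_sum (A : Matrix (Fin n) (Fin n) ℤ) (c : Fin n → ℤ) (k : Fin n) :
    simplePairing A c k = ∑ l, c l * A l k :=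
  (Fin.sum_univ_def _).symm

/-- The action of the `k`-th simple reflection on simple root coordinates. -/
def simpleReflect (A : Matrix (Fin n) (Fin n) ℤ) (k : Fin n) (c : Fin n → ℤ) : Fin n → ℤ :=
  fun j => if j = k then c j - simplePairing A c k else c j

/-- The check that all vectors reached from `c` by at most `d` simple reflections that lower them
have non-negative coordinates. Each vector is reached only from its reflection in the first simple
coroot that is negative on it. -/
def conesBelow (A : Matrix (Fin n) (Fin n) ℤ) : ℕ → (Fin n → ℤ) → Bool
  | 0, c => (List.finRange n).all fun k => 0 ≤ c k
  | d + 1, c => ((List.finRange n).all fun k => 0 ≤ c k) &&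
      (List.finRange n).all fun k => !(decide (0 < simplePairing A c k) &&
        (List.finRange n).all fun j => k ≤ j || 0 ≤ simplePairing A (simpleReflect A k c) j) ||
        conesBelow A d (simpleReflect A k c)

/-- The action of a word in the simple reflections on simple root coordinates; the last letter acts
first. -/
def wordReflect (A : Matrix (Fin n) (Fin n) ℤ) (L : List (Fin n)) (c : Fin n → ℤ) : Fin n → ℤ :=
  L.foldr (simpleReflect A) c

end Computation

section SimpleRootCoordinates

open Finset

variable {ι M N : Type*} [Finite ι] [AddCommGroup M] [Module ℝ M] [AddCommGroup N] [Module ℝ N]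
  {P : RootPairing ι ℝ M N} [P.IsRootSystem] [P.IsCrystallographic] [P.IsReduced] {b : P.Base}
  {n : ℕ} {A : Matrix (Fin n) (Fin n) ℤ} (e : b.support ≃ Fin n)

/-- The vector with integral simple root coordinates `c`. -/
noncomputable def ofCoords (c : Fin n → ℤ) : M := ∑ k, (c k : ℝ) • P.root (e.symm k : ι)

lemma ofCoords_neg (c : Fin n → ℤ) : ofCoords e (-c) = -ofCoords e c := by
  simp [ofCoords]

lemma ofCoords_add (c d : Fin n → ℤ) : ofCoords e (c + d) = ofCoords e c + ofCoords e d := by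
  simp [ofCoords, add_smul, sum_add_distrib]

lemma ofCoords_mem_positiveRootCone_iff (c : Fin n → ℤ) :
    ofCoords e c ∈ b.positiveRootCone ↔ ∀ k, 0 ≤ c k := by
  have hrep : ∀ i, b.toWeightBasis.repr (ofCoords e c) i = c (e i) := by
    classical
    intro i
    rw [ofCoords, map_sum, Finsupp.finsetSum_apply, sum_eq_single (e i)]
    · simp
    · intro k _ hk
      rw [map_smul, toWeightBasis_repr_root, Finsupp.smul_apply, Finsupp.single_apply, if_neg,
        smul_zero]
      rintro rfl
      exact hk (e.apply_symm_apply k).symm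
    · simp
  rw [mem_positiveRootCone_iff]
  refine ⟨fun h k => ?_, fun h i => ?_⟩
  · have := h (e.symm k)
    rw [hrep, e.apply_symm_apply] at this
    exact_mod_cast this
  · rw [hrep]; exact_mod_cast h _

variable {e} (he : ∀ i j : b.support, b.cartanMatrix i j = A (e i) (e j))

include he

lemma coroot'_ofCoords (c : Fin n → ℤ) (k : Fin n) :
    P.coroot' (e.symm k : ι) (ofCoords e c) = simplePairing A c k := by
  rw [simplePairing_eq_sum, ofCoords, map_sum]
  push_cast
  refine sum_congr rfl fun l _ => ?_
  have := he (e.symm l) (e.symm k)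
  rw [e.apply_symm_apply, e.apply_symm_apply] at this
  rw [map_smul, root_coroot'_eq_pairing, ← P.algebraMap_pairingIn ℤ, ← this]
  rfl

lemma ofIdx_smul_ofCoords (c : Fin n → ℤ) (k : Fin n) :
    weylGroup.ofIdx P (e.symm k : ι) • ofCoords e c = ofCoords e (simpleReflect A k c) := by
  have hsplit : simpleReflect A k c = c - Pi.single k (simplePairing A c k) := by
    ext j
    simp only [simpleReflect, Pi.sub_apply, Pi.single_apply]
    split_ifs <;> simp
  rw [ofIdx_smul_eq, coroot'_ofCoords he, hsplit, sub_eq_add_neg, sub_eq_add_neg, ofCoords_add,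
    ofCoords_neg]
  congr 2
  rw [ofCoords, sum_eq_single k]
  · simp
  · intro j _ hj; simp [hj]
  · simp

lemma exists_smul_ofCoords_eq (L : List (Fin n)) : ∃ w : P.weylGroup, b.weylLength w ≤ L.length ∧
    ∀ c, w • ofCoords e c = ofCoords e (wordReflect A L c) := by
  induction L with
  | nil => exact ⟨1, by simp [weylLength_one], fun c => by simp [wordReflect]⟩
  | cons k L ih =>
    obtain ⟨w, hw, hw'⟩ := ih
    refine ⟨weylGroup.ofIdx P (e.symm k : ι) * w, (b.weylLength_ofIdx_mul_le (e.symm k).2 w).trans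
      (by simpa using hw), fun c => ?_⟩
    rw [mul_smul, hw', ofIdx_smul_ofCoords he]; rfl

lemma ofCoords_mem_dominantWeights {c : Fin n → ℤ} (hc : ∀ k, 0 ≤ simplePairing A c k) :
    ofCoords e c ∈ b.dominantWeights := by
  have key : ∀ i ∈ b.support, ∃ k, P.coroot' i (ofCoords e c) = simplePairing A c k :=
    fun i hi => ⟨e ⟨i, hi⟩, by rw [← coroot'_ofCoords he, e.symm_apply_apply]⟩
  rw [mem_dominantWeights_iff]
  refine ⟨fun i hi => ?_, fun i hi => ?_⟩ <;> obtain ⟨k, hk⟩ := key i hi <;> rw [hk]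
  · exact ⟨_, rfl⟩
  · exact_mod_cast hc k

/-- The check `conesBelow` covers all vectors in the orbit of a dominant vector that are negative on
at most `d` positive coroots: reflecting in the first negative simple coroot, again and again, leads
back to the dominant vector in at most `d` steps. -/
lemma smul_mem_positiveRootCone_of_conesBelow {c : Fin n → ℤ} (hc : ∀ k, 0 ≤ simplePairing A c k)
    {d : ℕ} (hd : conesBelow A d c = true) (w : P.weylGroup)
    (hw : b.negCount (w • ofCoords e c) ≤ d) : w • ofCoords e c ∈ b.positiveRootCone := by
  suffices ∃ c', w • ofCoords e c = ofCoords e c' ∧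
      ∃ d', d ≤ d' + b.negCount (w • ofCoords e c) ∧ conesBelow A d' c' = true by
    obtain ⟨c', hc', d', -, hd'⟩ := this
    rw [hc', ofCoords_mem_positiveRootCone_iff]
    cases d' with
    | zero => simpa [conesBelow] using hd'
    | succ d' =>
      rw [conesBelow, Bool.and_eq_true] at hd'
      simpa using hd'.1
  induction hm : b.negCount (w • ofCoords e c) using Nat.strong_induction_on generalizing w with
  | _ m ih =>
    subst hm
    by_cases hdom : ∀ k, 0 ≤ P.coroot' (e.symm k : ι) (w • ofCoords e c)
    · have hdom' : ∀ i ∈ b.support, 0 ≤ P.coroot' i (w • ofCoords e c) := fun i hi => by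
        have := hdom (e ⟨i, hi⟩)
        rwa [e.symm_apply_apply] at this
      rw [b.eq_of_dominant_of_smul_eq (ofCoords_mem_dominantWeights he hc).2 hdom' rfl]
      exact ⟨c, rfl, d, by omega, hd⟩
    · push Not at hdom
      -- the first negative simple coroot
      obtain ⟨k, hk, hkmin⟩ : ∃ k, P.coroot' (e.symm k : ι) (w • ofCoords e c) < 0 ∧
          ∀ j < k, 0 ≤ P.coroot' (e.symm j : ι) (w • ofCoords e c) := by
        obtain ⟨k, hk, hkmin⟩ := wellFounded_lt.has_min
          {k | P.coroot' (e.symm k : ι) (w • ofCoords e c) < 0} hdom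
        exact ⟨k, hk, fun j hj => not_lt.1 fun h => hkmin j h hj⟩
      have hlt := b.negCount_ofIdx_smul_lt (e.symm k).2 hk
      rw [← mul_smul] at hlt
      obtain ⟨c', hc', d', hd', hcone⟩ := ih _ hlt _ (by omega) rfl
      have hback : w • ofCoords e c = ofCoords e (simpleReflect A k c') := by
        rw [← ofIdx_smul_ofCoords he, ← hc', mul_smul, ← mul_smul (weylGroup.ofIdx P _),
          ofIdx_mul_self, one_smul]
      obtain ⟨d', rfl⟩ : ∃ r, d' = r + 1 := ⟨d' - 1, by omega⟩
      refine ⟨_, hback, d', by omega, ?_⟩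
      rw [conesBelow, Bool.and_eq_true] at hcone
      have h1 := List.all_eq_true.1 hcone.2 k (List.mem_finRange k)
      have h2 : 0 < simplePairing A c' k := by
        have h3 : w • ofCoords e c = weylGroup.ofIdx P (e.symm k : ι) • ofCoords e c' := by
          rw [ofIdx_smul_ofCoords he, hback]
        rw [h3, ofIdx_smul_eq, map_sub, map_smul, root_coroot'_eq_pairing, P.pairing_same,
          coroot'_ofCoords he, smul_eq_mul] at hk
        have : (0 : ℝ) < simplePairing A c' k := by linarith
        exact_mod_cast this
      have h3 : ((List.finRange n).all fun j =>
          decide (k ≤ j) || decide (0 ≤ simplePairing A (simpleReflect A k c') j)) = true := by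
        rw [List.all_eq_true]
        intro j _
        rcases le_or_gt k j with hkj | hkj
        · simp [hkj]
        · have := hkmin j hkj
          rw [hback, coroot'_ofCoords he] at this
          have : 0 ≤ simplePairing A (simpleReflect A k c') j := by exact_mod_cast this
          simp [this]
      rw [h3, decide_eq_true h2] at h1
      simpa using h1

/-- Expansion of a vector in terms of the multiples `ofCoords e (B k)` of the fundamental
weights. -/
lemma eq_sum_smul_ofCoords {B : Fin n → Fin n → ℤ} {D : ℤ} (hD : 0 < D)
    (hB : ∀ k j, simplePairing A (B k) j = if k = j then D else 0) (v : M) :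
    v = ∑ k, (P.coroot' (e.symm k : ι) v / D) • ofCoords e (B k) := by
  refine b.ext_coroot' fun i hi => ?_
  obtain ⟨j, rfl⟩ : ∃ j, i = e.symm j := ⟨e ⟨i, hi⟩, by simp⟩
  have hD' : (D : ℝ) ≠ 0 := by exact_mod_cast hD.ne'
  rw [map_sum, sum_eq_single j]
  · rw [map_smul, coroot'_ofCoords he, hB, if_pos rfl, smul_eq_mul, div_mul_cancel₀ _ hD']
  · intro k _ hk
    rw [map_smul, coroot'_ofCoords he, hB, if_neg hk, Int.cast_zero, smul_zero]
  · simp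

/-- A lower bound for the lengths of elements moving a `σ`-invariant dominant vector out of the
cone, for an involution `σ` of the simple roots: such a vector is a non-negative combination of the
vectors `B k + B (σ k)`. -/
lemma lt_weylLength_of_conesBelow {B : Fin n → Fin n → ℤ} {D : ℤ} (hD : 0 < D)
    (hB : ∀ k j, simplePairing A (B k) j = if k = j then D else 0) {σ : Fin n → Fin n}
    (hσ : ∀ k, σ (σ k) = k) {d : ℕ} (htree : ∀ k, conesBelow A d (B k + B (σ k)) = true)
    {v : M} (hv : ∀ k ∈ b.support, 0 ≤ P.coroot' k v)
    (hvσ : ∀ k, P.coroot' (e.symm (σ k) : ι) v = P.coroot' (e.symm k : ι) v)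
    {w : P.weylGroup} (hw : w • v ∉ b.positiveRootCone) : d < b.weylLength w := by
  by_contra hle
  apply hw
  have hD' : (0 : ℝ) < D := by exact_mod_cast hD
  have h1 := eq_sum_smul_ofCoords he hD hB v
  have h2 : v = ∑ k, (P.coroot' (e.symm k : ι) v / D) • ofCoords e (B (σ k)) := by
    conv_lhs => rw [h1]
    refine (sum_nbij' σ σ (by simp) (by simp) (by simp [hσ]) (by simp [hσ]) fun k _ => ?_).symm
    rw [hvσ]
  have h3 : v = ∑ k, (P.coroot' (e.symm k : ι) v / D / 2) • ofCoords e (B k + B (σ k)) := by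
    have h4 : v = (2⁻¹ : ℝ) • (v + v) := by rw [← two_smul ℝ v, smul_smul]; norm_num
    conv_lhs => rw [h4]
    nth_rewrite 1 [h1]
    nth_rewrite 2 [h2]
    rw [← sum_add_distrib, smul_sum]
    refine sum_congr rfl fun k _ => ?_
    rw [ofCoords_add, ← smul_add, smul_smul]
    congr 1
    ring
  have hdom : ∀ k j, 0 ≤ simplePairing A (B k + B (σ k)) j := by
    intro k j
    have : simplePairing A (B k + B (σ k)) j = simplePairing A (B k) j +
        simplePairing A (B (σ k)) j := by
      simp only [simplePairing_eq_sum, Pi.add_apply, add_mul, sum_add_distrib]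
    rw [this, hB, hB]
    split_ifs <;> omega
  rw [h3, smul_sum]
  refine sum_mem fun k _ => ?_
  rw [smul_comm]
  refine b.smul_mem_positiveRootCone ?_ (smul_mem_positiveRootCone_of_conesBelow he (hdom k)
    (htree k) w ((b.negCount_smul_le (ofCoords_mem_dominantWeights he (hdom k)).2 w).trans
      (not_lt.1 hle)))
  exact div_nonneg (div_nonneg (hv _ (e.symm k).2) hD'.le) (by norm_num)

/-- If some Weyl group element acts on the fundamental weights as the negative of a permutation `σ`,
then the self-dual weights are invariant under `σ`. -/
lemma coroot'_eq_of_selfDual {B : Fin n → Fin n → ℤ} {D : ℤ} (hD : 0 < D)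
    (hB : ∀ k j, simplePairing A (B k) j = if k = j then D else 0) {σ : Fin n → Fin n}
    (hσ : ∀ k, σ (σ k) = k) {L : List (Fin n)}
    (hL : ∀ k, wordReflect A L (B k) = - B (σ k)) {v : M} (hv : v ∈ b.selfDualDominantWeights)
    (k : Fin n) : P.coroot' (e.symm (σ k) : ι) v = P.coroot' (e.symm k : ι) v := by
  rw [mem_selfDualDominantWeights_iff] at hv
  obtain ⟨hv, u, hu⟩ := hv
  obtain ⟨w, -, hw⟩ := exists_smul_ofCoords_eq he L
  have hD' : (D : ℝ) ≠ 0 := by exact_mod_cast hD.ne'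
  have hcor : ∀ j, P.coroot' (e.symm j : ι) (-(w • v)) = P.coroot' (e.symm (σ j) : ι) v := by
    intro j
    conv_lhs => rw [eq_sum_smul_ofCoords he hD hB v]
    rw [smul_sum, ← sum_neg_distrib, map_sum, sum_eq_single (σ j)]
    · rw [smul_comm, hw, hL, hσ, ofCoords_neg, smul_neg, neg_neg, map_smul, coroot'_ofCoords he,
        hB, if_pos rfl, smul_eq_mul, div_mul_cancel₀ _ hD']
    · intro i _ hi
      rw [smul_comm, hw, hL, ofCoords_neg, smul_neg, neg_neg, map_smul, coroot'_ofCoords he,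
        hB, if_neg, Int.cast_zero, smul_zero]
      rintro rfl
      exact hi (hσ i).symm
    · simp
  have heq : -(w • v) = v := by
    refine b.eq_of_dominant_of_smul_eq hv.2 (w := w * u) (fun i hi => ?_) ?_
    · have := hcor (e ⟨i, hi⟩)
      rw [e.symm_apply_apply] at this
      rw [this]
      exact hv.2 _ (e.symm _).2
    · rw [mul_smul, hu, smul_neg]
  rw [← hcor, heq]

lemma ofCoords_mem_selfDualDominantWeights {c : Fin n → ℤ} (hc : ∀ k, 0 ≤ simplePairing A c k)
    {L : List (Fin n)} (hL : wordReflect A L c = -c) :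
    ofCoords e c ∈ b.selfDualDominantWeights := by
  rw [mem_selfDualDominantWeights_iff]
  obtain ⟨w, -, hw⟩ := exists_smul_ofCoords_eq he L
  exact ⟨ofCoords_mem_dominantWeights he hc, w, by rw [hw, hL, ofCoords_neg]⟩

/-- If `-1` is in the Weyl group then all dominant weights are self-dual, so that the two invariants
agree. -/
lemma ellSdInvariant_eq_ellInvariant {B : Fin n → Fin n → ℤ} {D : ℤ} (hD : 0 < D)
    (hB : ∀ k j, simplePairing A (B k) j = if k = j then D else 0) {L : List (Fin n)}
    (hL : ∀ k, wordReflect A L (B k) = - B k) :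
    b.ellSdInvariant = b.ellInvariant := by
  suffices b.selfDualDominantWeights = b.dominantWeights by
    rw [ellSdInvariant, ellInvariant, this]
  ext v
  rw [mem_selfDualDominantWeights_iff, and_iff_left_iff_imp]
  intro _
  obtain ⟨w, -, hw⟩ := exists_smul_ofCoords_eq he L
  refine ⟨w, ?_⟩
  conv_lhs => rw [eq_sum_smul_ofCoords he hD hB v]
  conv_rhs => rw [eq_sum_smul_ofCoords he hD hB v]
  rw [smul_sum, ← sum_neg_distrib]
  refine sum_congr rfl fun k _ => ?_
  rw [smul_comm, hw, hL, ofCoords_neg, smul_neg]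

/-- Bounds for `ℓ` from a search through the orbits of the fundamental weights and a word. -/
lemma ellInvariant_bounds {B : Fin n → Fin n → ℤ} {D : ℤ} (hD : 0 < D)
    (hB : ∀ k j, simplePairing A (B k) j = if k = j then D else 0) {d : ℕ}
    (htree : ∀ k, conesBelow A d (B k + B k) = true) {c : Fin n → ℤ}
    (hc : ∀ k, 0 ≤ simplePairing A c k) {L : List (Fin n)} (hL : ∃ k, wordReflect A L c k < 0) :
    d + 1 ≤ b.ellInvariant ∧ b.ellInvariant ≤ L.length := by
  obtain ⟨w, hw, hw'⟩ := exists_smul_ofCoords_eq he L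
  have hdom := ofCoords_mem_dominantWeights he hc
  have hbad : w • ofCoords e c ∉ b.positiveRootCone := by
    rw [hw', ofCoords_mem_positiveRootCone_iff]
    push Not
    exact hL
  exact ⟨b.le_ellInvariant' hdom hbad fun w v hv h => lt_weylLength_of_conesBelow he hD hB
    (σ := id) (fun _ => rfl) htree hv.2 (fun _ => rfl) h, (b.ellInvariant_le hdom hbad).trans hw⟩

/-- Bounds for `ℓ` for self-dual weights from a search through the orbits of the sums of two dual
fundamental weights and a word. -/
lemma ellSdInvariant_bounds {B : Fin n → Fin n → ℤ} {D : ℤ} (hD : 0 < D)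
    (hB : ∀ k j, simplePairing A (B k) j = if k = j then D else 0) {σ : Fin n → Fin n}
    (hσ : ∀ k, σ (σ k) = k) {d : ℕ} (htree : ∀ k, conesBelow A d (B k + B (σ k)) = true)
    {L₀ : List (Fin n)} (hL₀ : ∀ k, wordReflect A L₀ (B k) = - B (σ k)) {c : Fin n → ℤ}
    (hc : ∀ k, 0 ≤ simplePairing A c k) (hc' : wordReflect A L₀ c = -c) {L : List (Fin n)}
    (hL : ∃ k, wordReflect A L c k < 0) :
    d + 1 ≤ b.ellSdInvariant ∧ b.ellSdInvariant ≤ L.length := by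
  obtain ⟨w, hw, hw'⟩ := exists_smul_ofCoords_eq he L
  have hsd := ofCoords_mem_selfDualDominantWeights he hc hc'
  have hbad : w • ofCoords e c ∉ b.positiveRootCone := by
    rw [hw', ofCoords_mem_positiveRootCone_iff]
    push Not
    exact hL
  exact ⟨b.le_ellSdInvariant' hsd hbad fun w v hv h => lt_weylLength_of_conesBelow he hD hB hσ
    htree hv.1.2 (coroot'_eq_of_selfDual he hD hB hσ hL₀ hv) h,
    (b.ellSdInvariant_le hsd hbad).trans hw⟩

end SimpleRootCoordinates

/-! ### The exceptional types and D₅ -/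

section Exceptional

variable {ι M N : Type*} [Finite ι] [AddCommGroup M] [Module ℝ M] [AddCommGroup N] [Module ℝ N]
  {P : RootPairing ι ℝ M N} [P.IsRootSystem] [P.IsCrystallographic] [P.IsReduced] {b : P.Base}

/-- Three times the fundamental weights of type `E₆` in simple root coordinates. -/
def fundamentalWeightsE₆ : Fin 6 → Fin 6 → ℤ :=
  ![![4, 3, 5, 6, 4, 2],
    ![3, 6, 6, 9, 6, 3],
    ![5, 6, 10, 12, 8, 4],
    ![6, 9, 12, 18, 12, 6],
    ![4, 6, 8, 12, 10, 5],
    ![2, 3, 4, 6, 5, 4]]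

lemma simplePairing_fundamentalWeightsE₆ : ∀ k j,
    simplePairing CartanMatrix.E₆ (fundamentalWeightsE₆ k) j = if k = j then 3 else 0 := by
  decide +kernel

/-- Twice the fundamental weights of type `E₇` in simple root coordinates. -/
def fundamentalWeightsE₇ : Fin 7 → Fin 7 → ℤ :=
  ![![4, 4, 6, 8, 6, 4, 2],
    ![4, 7, 8, 12, 9, 6, 3],
    ![6, 8, 12, 16, 12, 8, 4],
    ![8, 12, 16, 24, 18, 12, 6],
    ![6, 9, 12, 18, 15, 10, 5],
    ![4, 6, 8, 12, 10, 8, 4],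
    ![2, 3, 4, 6, 5, 4, 3]]

lemma simplePairing_fundamentalWeightsE₇ : ∀ k j,
    simplePairing CartanMatrix.E₇ (fundamentalWeightsE₇ k) j = if k = j then 2 else 0 := by
  decide +kernel

/-- The fundamental weights of type `E₈` in simple root coordinates. -/
def fundamentalWeightsE₈ : Fin 8 → Fin 8 → ℤ :=
  ![![4, 5, 7, 10, 8, 6, 4, 2],
    ![5, 8, 10, 15, 12, 9, 6, 3],
    ![7, 10, 14, 20, 16, 12, 8, 4],
    ![10, 15, 20, 30, 24, 18, 12, 6],
    ![8, 12, 16, 24, 20, 15, 10, 5],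
    ![6, 9, 12, 18, 15, 12, 8, 4],
    ![4, 6, 8, 12, 10, 8, 6, 3],
    ![2, 3, 4, 6, 5, 4, 3, 2]]

lemma simplePairing_fundamentalWeightsE₈ : ∀ k j,
    simplePairing CartanMatrix.E₈ (fundamentalWeightsE₈ k) j = if k = j then 1 else 0 := by
  decide +kernel

/-- The fundamental weights of type `F₄` in simple root coordinates. -/
def fundamentalWeightsF₄ : Fin 4 → Fin 4 → ℤ :=
  ![![2, 3, 4, 2],
    ![3, 6, 8, 4],
    ![2, 4, 6, 3],
    ![1, 2, 3, 2]]

lemma simplePairing_fundamentalWeightsF₄ : ∀ k j,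
    simplePairing CartanMatrix.F₄ (fundamentalWeightsF₄ k) j = if k = j then 1 else 0 := by
  decide +kernel

/-- The fundamental weights of type `G₂` in simple root coordinates. -/
def fundamentalWeightsG₂ : Fin 2 → Fin 2 → ℤ :=
  ![![2, 3],
    ![1, 2]]

lemma simplePairing_fundamentalWeightsG₂ : ∀ k j,
    simplePairing CartanMatrix.G₂ (fundamentalWeightsG₂ k) j = if k = j then 1 else 0 := by
  decide +kernel

/-- Four times the fundamental weights of type `D₅` in simple root coordinates. -/
def fundamentalWeightsD₅ : Fin 5 → Fin 5 → ℤ :=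
  ![![4, 4, 4, 2, 2],
    ![4, 8, 8, 4, 4],
    ![4, 8, 12, 6, 6],
    ![2, 4, 6, 5, 3],
    ![2, 4, 6, 3, 5]]

lemma simplePairing_fundamentalWeightsD₅ : ∀ k j,
    simplePairing (CartanMatrix.D 5) (fundamentalWeightsD₅ k) j = if k = j then 4 else 0 := by
  decide +kernel

lemma HasCartanType.ellInvariant_E₆ (h : b.HasCartanType CartanMatrix.E₆) :
    b.ellInvariant = 5 := by
  obtain ⟨e, he⟩ := h
  have h := ellInvariant_bounds he (D := 3) (by norm_num)
    simplePairing_fundamentalWeightsE₆ (d := 4) (by decide +kernel)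
    (c := fundamentalWeightsE₆ 0) (by decide +kernel)
    (L := [5, 4, 3, 2, 0]) (by decide +kernel)
  exact le_antisymm h.2 h.1

lemma HasCartanType.ellSdInvariant_E₆ (h : b.HasCartanType CartanMatrix.E₆) :
    b.ellSdInvariant = 9 := by
  obtain ⟨e, he⟩ := h
  have h := ellSdInvariant_bounds he (D := 3) (by norm_num)
    simplePairing_fundamentalWeightsE₆ (σ := ![5, 1, 4, 3, 2, 0]) (by decide) (d := 8)
    -- a power of a Coxeter element that acts as the negative of the diagram symmetry
    (by decide +kernel) (L₀ := (List.replicate 6 [0, 3, 5, 1, 2, 4]).flatten)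
    (by decide +kernel) (c := fundamentalWeightsE₆ 0 + fundamentalWeightsE₆ 5)
    (by decide +kernel) (by decide +kernel) (L := [0, 2, 3, 4, 5, 1, 3, 2, 0]) (by decide +kernel)
  exact le_antisymm h.2 h.1

lemma HasCartanType.ellInvariant_D₅ (h : b.HasCartanType (CartanMatrix.D 5)) :
    b.ellInvariant = 3 := by
  obtain ⟨e, he⟩ := h
  have h := ellInvariant_bounds he (D := 4) (by norm_num)
    simplePairing_fundamentalWeightsD₅ (d := 2) (by decide +kernel)
    (c := fundamentalWeightsD₅ 3) (by decide +kernel)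
    (L := [4, 2, 3]) (by decide +kernel)
  exact le_antisymm h.2 h.1

lemma HasCartanType.ellSdInvariant_D₅ (h : b.HasCartanType (CartanMatrix.D 5)) :
    b.ellSdInvariant = 4 := by
  obtain ⟨e, he⟩ := h
  have h := ellSdInvariant_bounds he (D := 4) (by norm_num)
    simplePairing_fundamentalWeightsD₅ (σ := ![0, 1, 2, 4, 3]) (by decide) (d := 3)
    -- a power of a Coxeter element that acts as the negative of the diagram symmetry
    (by decide +kernel) (L₀ := (List.replicate 4 [0, 1, 2, 3, 4]).flatten)
    (by decide +kernel) (c := fundamentalWeightsD₅ 0)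
    (by decide +kernel) (by decide +kernel) (L := [3, 2, 1, 0]) (by decide +kernel)
  exact le_antisymm h.2 h.1

lemma HasCartanType.ellInvariant_E₇ (h : b.HasCartanType CartanMatrix.E₇) :
    b.ellInvariant = 10 := by
  obtain ⟨e, he⟩ := h
  have h := ellInvariant_bounds he (D := 2) (by norm_num)
    simplePairing_fundamentalWeightsE₇ (d := 9) (by decide +kernel)
    (c := fundamentalWeightsE₇ 6) (by decide +kernel)
    (L := [6, 5, 4, 3, 2, 1, 3, 4, 5, 6]) (by decide +kernel)
  exact le_antisymm h.2 h.1

/-- A power of a Coxeter element acts as `-1`. -/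
lemma HasCartanType.ellSdInvariant_E₇ (h : b.HasCartanType CartanMatrix.E₇) :
    b.ellSdInvariant = b.ellInvariant := by
  obtain ⟨e, he⟩ := h
  refine ellSdInvariant_eq_ellInvariant he (D := 2) (by norm_num)
    simplePairing_fundamentalWeightsE₇ (L := (List.replicate 9 (List.finRange 7)).flatten) ?_
  decide +kernel

lemma HasCartanType.ellInvariant_E₈ (h : b.HasCartanType CartanMatrix.E₈) :
    7 ≤ b.ellInvariant ∧ b.ellInvariant ≤ 29 := by
  obtain ⟨e, he⟩ := h
  have h := ellInvariant_bounds he (D := 1) (by norm_num)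
    simplePairing_fundamentalWeightsE₈ (d := 6) (by decide +kernel)
    (c := fundamentalWeightsE₈ 7) (by decide +kernel)
    (L := [7, 6, 5, 4, 3, 2, 1, 3, 4, 5, 6, 0, 2, 3, 4, 5, 1, 3, 4, 2, 3, 0, 2, 1, 3, 4, 5, 6, 7])
    (by decide +kernel)
  exact h

/-- A power of a Coxeter element acts as `-1`. -/
lemma HasCartanType.ellSdInvariant_E₈ (h : b.HasCartanType CartanMatrix.E₈) :
    b.ellSdInvariant = b.ellInvariant := by
  obtain ⟨e, he⟩ := h
  refine ellSdInvariant_eq_ellInvariant he (D := 1) (by norm_num)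
    simplePairing_fundamentalWeightsE₈ (L := (List.replicate 15 (List.finRange 8)).flatten) ?_
  decide +kernel

lemma HasCartanType.ellInvariant_F₄ (h : b.HasCartanType CartanMatrix.F₄) :
    b.ellInvariant = 8 := by
  obtain ⟨e, he⟩ := h
  have h := ellInvariant_bounds he (D := 1) (by norm_num)
    simplePairing_fundamentalWeightsF₄ (d := 7) (by decide +kernel)
    (c := fundamentalWeightsF₄ 0) (by decide +kernel)
    (L := [1, 2, 3, 0, 1, 2, 1, 0]) (by decide +kernel)
  exact le_antisymm h.2 h.1

/-- A power of a Coxeter element acts as `-1`. -/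
lemma HasCartanType.ellSdInvariant_F₄ (h : b.HasCartanType CartanMatrix.F₄) :
    b.ellSdInvariant = b.ellInvariant := by
  obtain ⟨e, he⟩ := h
  refine ellSdInvariant_eq_ellInvariant he (D := 1) (by norm_num)
    simplePairing_fundamentalWeightsF₄ (L := (List.replicate 6 (List.finRange 4)).flatten) ?_
  decide +kernel

lemma HasCartanType.ellInvariant_G₂ (h : b.HasCartanType CartanMatrix.G₂) :
    b.ellInvariant = 3 := by
  obtain ⟨e, he⟩ := h
  have h := ellInvariant_bounds he (D := 1) (by norm_num)
    simplePairing_fundamentalWeightsG₂ (d := 2) (by decide +kernel)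
    (c := fundamentalWeightsG₂ 0) (by decide +kernel)
    (L := [0, 1, 0]) (by decide +kernel)
  exact le_antisymm h.2 h.1

/-- A power of a Coxeter element acts as `-1`. -/
lemma HasCartanType.ellSdInvariant_G₂ (h : b.HasCartanType CartanMatrix.G₂) :
    b.ellSdInvariant = b.ellInvariant := by
  obtain ⟨e, he⟩ := h
  refine ellSdInvariant_eq_ellInvariant he (D := 1) (by norm_num)
    simplePairing_fundamentalWeightsG₂ (L := (List.replicate 3 (List.finRange 2)).flatten) ?_
  decide +kernel

end Exceptional

end RootPairing.Base

theorem mainTheorem2 {ι M N : Type*} [Finite ι] [AddCommGroup M] [Module ℝ M]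
    [AddCommGroup N] [Module ℝ N] (P : RootPairing ι ℝ M N) [P.IsRootSystem]
    [P.IsCrystallographic] [P.IsReduced] (b : P.Base) :
    (∀ n : ℕ, 1 ≤ n → b.HasCartanType (CartanMatrix.A n) →
      b.ellInvariant = 1 ∧ b.ellSdInvariant = (n + 2) / 2) ∧
    (∀ n : ℕ, 2 ≤ n → b.HasCartanType (CartanMatrix.B n) →
      b.ellInvariant = n ∧ b.ellSdInvariant = n) ∧
    (∀ n : ℕ, 2 ≤ n → b.HasCartanType (CartanMatrix.C n) →
      b.ellInvariant = n ∧ b.ellSdInvariant = n) ∧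
    (∀ n : ℕ, 4 ≤ n → b.HasCartanType (CartanMatrix.D n) →
      b.ellInvariant = (if n = 5 then 3 else n - 1) ∧ b.ellSdInvariant = n - 1) ∧
    (b.HasCartanType CartanMatrix.E₆ → b.ellInvariant = 5 ∧ b.ellSdInvariant = 9) ∧
    (b.HasCartanType CartanMatrix.E₇ → b.ellInvariant = 10 ∧ b.ellSdInvariant = 10) ∧
    (b.HasCartanType CartanMatrix.E₈ →
      7 ≤ b.ellInvariant ∧ b.ellInvariant ≤ 29 ∧ b.ellSdInvariant = b.ellInvariant) ∧
    (b.HasCartanType CartanMatrix.F₄ → b.ellInvariant = 8 ∧ b.ellSdInvariant = 8) ∧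
    (b.HasCartanType CartanMatrix.G₂ → b.ellInvariant = 3 ∧ b.ellSdInvariant = 3) := by
  refine ⟨fun n hn h => ⟨h.ellInvariant_A hn, h.ellSdInvariant_A hn⟩, fun n hn h => ?_,
    fun n hn h => ?_, fun n hn h => ?_, fun h => ⟨h.ellInvariant_E₆, h.ellSdInvariant_E₆⟩,
    fun h => ⟨h.ellInvariant_E₇, h.ellSdInvariant_E₇.trans h.ellInvariant_E₇⟩,
    fun h => ⟨h.ellInvariant_E₈.1, h.ellInvariant_E₈.2, h.ellSdInvariant_E₈⟩,
    fun h => ⟨h.ellInvariant_F₄, h.ellSdInvariant_F₄.trans h.ellInvariant_F₄⟩,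
    fun h => ⟨h.ellInvariant_G₂, h.ellSdInvariant_G₂.trans h.ellInvariant_G₂⟩⟩
  · obtain ⟨m, rfl⟩ := Nat.exists_eq_add_of_le' hn
    obtain ⟨φ, hφ⟩ := h.exists_realization_B
    exact hφ.ell_eq (by norm_num)
  · obtain ⟨m, rfl⟩ := Nat.exists_eq_add_of_le' hn
    obtain ⟨φ, hφ⟩ := h.exists_realization_C
    exact hφ.ell_eq (by norm_num)
  · by_cases h5 : n = 5
    · subst h5
      exact ⟨h.ellInvariant_D₅, h.ellSdInvariant_D₅⟩
    · obtain ⟨m, rfl⟩ := Nat.exists_eq_add_of_le' (show 2 ≤ n by omega)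
      obtain ⟨φ, hφ⟩ := h.exists_realization_D (by omega)
      rw [if_neg h5]
      exact hφ.ell_eq (by omega) (by omega)
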